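/- Assume the Hardy--Littlewood Conjecture: for all integers $a>0,b,c$ with $\gcd(a,b,c)=1$, with $a+b$ and $c$ not both even and with $\Delta=b^2-4ac$ not a perfect square, the number of primes $p<n$ of the form $p=ax^2+bx+c$, $x\in\mathbb Z_{\ge 0}$, is asymptotic, as $n\to\infty$, to $\delta(a,b,c)\sqrt n/\log n$, where $$\delta(a,b,c)=\frac{\gcd(2,a+b)}{\sqrt a}\prod_{\substack{p\mid a,\ p\mid b\\ p>2}}\frac{p}{p-1}\prod_{\substack{p\nmid a\\ p>2}}\left(1-\frac{\left(\frac{\Delta}{p}\right)}{p-1}\right)$$ (the infinite product is taken over primes in increasing order). For a nonzero integer $D$ let $E_D: y^2=x^3+Dx$ and, for a prime $p$ of good reduction, $a_p(E_D)=p+1-\#\tilde E_D(\mathbb F_p)$. For an integer $r$ let $Q(r,N)$ be the set of primes $p\le N$ of the form $p=r^2+x^2$ with $x\in\mathbb Z$, and put $$a_p(2r)=\lim_{N\to\infty}\frac{\#\{p\in Q(r,N): E_D\text{ has good reduction at }p,\ a_p(E_D)=2r\}}{\#Q(r,N)}.$$ Fix an integer $\alpha\equiv 1\pmod 4$, and let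 $D$ be a nonzero integer not divisible by the fourth power of a prime. Write $D=d\bar d$, where $d>0$ is odd, every prime factor of $d$ divides $\alpha$, and $(\alpha,\bar d)=1$. Write $$d=d_pd_q^2d_l^3,\qquad \bar d=\pm2^{\sigma}\,\bar d_p\,\bar d_q^{\,2}\,\bar d_l^{\,3},\qquad 0\le\sigma\le 3,$$ where $d_p,d_q,d_l$ are square-free, pairwise coprime positive integers and $\bar d_p,\bar d_q,\bar d_l$ are odd, square-free, pairwise coprime positive integers. Let $r'',s'',t''$ be the numbers of prime factors of $\bar d_p,\bar d_q,\bar d_l$ respectively, and let $r_i',t_i',r_i'',t_i''$ be the numbers of prime factors $l\equiv i\pmod 8$ of $d_p,d_l,\bar d_p,\bar d_l$ respectively. For an odd prime $l$ let $\tau(l)=l$ if $l\equiv3\pmod4$ and $\tau(l)=l-2$ if $l\equiv 1\pmod 4$. Put $$A=\frac{(-1)^{r''+t''}}{\prod_{l\mid\bar d_p\bar d_l}\tau(l)},\qquad B=\frac{(-1)^{r_3'+r_5'+t_3'+t_5'+r_1''+r_7''+t_1''+t_7''+s''}}{\prod_{l\mid\bar d_p\bar d_q\bar d_l}\tau(l)},$$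 the products being over primes $l$. Then the limits $a_p(2\alpha)$ and $a_p(-2\alpha)$ exist, and: (1) Assume that $D$ is odd. If $D\equiv1\pmod4$, then $a_p(2\alpha)=\frac14(1+A+2B)$ and $a_p(-2\alpha)=\frac14(1+A-2B)$. If $D\equiv3\pmod4$, then $a_p(2\alpha)=a_p(-2\alpha)=\frac14(1+A)$. (2) Assume that $D$ is even. If $4\,\|\,D$ and $\frac D4\equiv1\pmod4$, then $a_p(2\alpha)=a_p(-2\alpha)=\frac14(1+A)$. If $4\,\|\,D$ and $\frac D4\equiv3\pmod4$, then $a_p(2\alpha)=\frac14(1+A+2B)$ and $a_p(-2\alpha)=\frac14(1+A-2B)$. If $2\,\|\,D$ or $8\,\|\,D$, then $a_p(2\alpha)=a_p(-2\alpha)=\frac14$. -/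

import Mathlib

open Filter Topology Asymptotics

noncomputable section

namespace LangTrotter

/-- The number of primes `p < n` that are of the form `a x ^ 2 + b x + c` with `x` a
natural number. -/
def quadPrimeCount (a b c : ℤ) (n : ℕ) : ℕ :=
  {p : ℕ | p.Prime ∧ p < n ∧ ∃ x : ℕ, (p : ℤ) = a * (x : ℤ) ^ 2 + b * (x : ℤ) + c}.ncard

/-- The partial product over the odd primes `p < M` with `p ∤ a` of
`1 - (Δ / p) / (p - 1)`, where `Δ = b ^ 2 - 4 a c` and `(Δ / p)` is the Legendre symbol. -/
def hlPartialProd (a b c : ℤ) (M : ℕ) : ℝ :=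
  ∏ p ∈ (Finset.range M).filter (fun p : ℕ => p.Prime ∧ 2 < p ∧ ¬ (p : ℤ) ∣ a),
    (1 - (jacobiSym (b ^ 2 - 4 * a * c) p : ℝ) / ((p : ℝ) - 1))

/-- The elementary factor of the Hardy-Littlewood constant:
`gcd (2, a + b) / √a` times the product of `p / (p - 1)` over the odd primes dividing
both `a` and `b`. -/
def hlFiniteFactor (a b : ℤ) : ℝ :=
  ((Int.gcd 2 (a + b) : ℕ) : ℝ) / Real.sqrt (a : ℝ) *
    ∏ p ∈ a.natAbs.primeFactors.filter (fun p : ℕ => 2 < p ∧ (p : ℤ) ∣ b),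
      ((p : ℝ) / ((p : ℝ) - 1))

/-- `δ` is the Hardy-Littlewood constant of `a x ^ 2 + b x + c`. The infinite product over
the primes `p ∤ a` converges only conditionally: it is taken in increasing order of `p`. -/
def IsHLConstant (a b c : ℤ) (δ : ℝ) : Prop :=
  Tendsto (fun M : ℕ => hlFiniteFactor a b * hlPartialProd a b c M) atTop (𝓝 δ)

/-- The Hardy-Littlewood Conjecture on primes represented by quadratic polynomials. -/
def HardyLittlewoodConjecture : Prop :=
  ∀ a b c : ℤ, 0 < a → Int.gcd (Int.gcd a b) c = 1 → ¬ (Even (a + b) ∧ Even c) →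
    ¬ IsSquare (b ^ 2 - 4 * a * c) →
    ∃ δ : ℝ, IsHLConstant a b c δ ∧
      (fun n : ℕ => (quadPrimeCount a b c n : ℝ)) ~[atTop]
        (fun n : ℕ => δ * (Real.sqrt (n : ℝ) / Real.log (n : ℝ)))

/-- The Weierstrass curve `y ^ 2 = x ^ 3 + D x` over `ℤ`. -/
def curveE (D : ℤ) : WeierstrassCurve ℤ := ⟨0, 0, 0, D, 0⟩

/-- `a_p = p + 1 - #E_D(𝔽_p)` (used only at primes of good reduction). -/
def frobTrace (D : ℤ) (p : ℕ) : ℤ :=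
  (p : ℤ) + 1 - (Nat.card ((curveE D).map (Int.castRingHom (ZMod p))).toAffine.Point : ℤ)

/-- `Q(r, N)`: the primes `p ≤ N` of the form `r ^ 2 + x ^ 2`. -/
def primesQ (r : ℤ) (N : ℕ) : Set ℕ :=
  {p : ℕ | p.Prime ∧ p ≤ N ∧ ∃ x : ℤ, (p : ℤ) = r ^ 2 + x ^ 2}

/-- The primes `p ∈ Q(r, N)` of good reduction for `E_D` such that `a_p(E_D) = 2 r`. -/
def primesTrace (D r : ℤ) (N : ℕ) : Set ℕ :=
  {p : ℕ | p ∈ primesQ r N ∧ ¬ (p : ℤ) ∣ (curveE D).Δ ∧ frobTrace D p = 2 * r}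

/-- The density `a_p(E_D, 2 r)` exists and equals `δ`. -/
def HasTraceDensity (D r : ℤ) (δ : ℝ) : Prop :=
  Tendsto (fun N : ℕ => ((primesTrace D r N).ncard : ℝ) / ((primesQ r N).ncard : ℝ))
    atTop (𝓝 δ)

/-- `Rad(n)`: the product of the odd prime factors of `n`. -/
def oddRad (n : ℤ) : ℕ := ∏ l ∈ n.natAbs.primeFactors.erase 2, l

/-- `τ(l)` for an odd prime `l`: it is `l - 2` if `l ≡ 1 (mod 4)` and `l` if
`l ≡ 3 (mod 4)`. -/
def tau (l : ℕ) : ℝ := if l % 4 = 1 then (l : ℝ) - 2 else (l : ℝ)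

/-- The number of prime factors of `n`. -/
def numPrimes (n : ℕ) : ℕ := n.primeFactors.card

/-- The number of prime factors of `n` that are congruent to `i` modulo `8`. -/
def numPrimesMod8 (i n : ℕ) : ℕ := (n.primeFactors.filter (fun l => l % 8 = i)).card

/-- `(-1) ^ (r'' + t'') / ∏_{l ∣ bp bl} τ(l)`. -/
def quadTerm (bp bl : ℕ) : ℝ :=
  (-1) ^ (numPrimes bp + numPrimes bl) / ∏ l ∈ (bp * bl).primeFactors, tau l

/-- `(-1) ^ (r₃' + r₅' + t₃' + t₅' + r₁'' + r₇'' + t₁'' + t₇'' + s'') / ∏_{l ∣ bp bq bl} τ(l)`. -/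
def quartTerm (dp dl bp bq bl : ℕ) : ℝ :=
  (-1) ^ (numPrimesMod8 3 dp + numPrimesMod8 5 dp + numPrimesMod8 3 dl + numPrimesMod8 5 dl
      + numPrimesMod8 1 bp + numPrimesMod8 7 bp + numPrimesMod8 1 bl + numPrimesMod8 7 bl
      + numPrimes bq)
    / ∏ l ∈ (bp * bq * bl).primeFactors, tau l

end LangTrotter

end

/-!
Let `p = α² + x²` with `α ≡ 1 (mod 4)` and `x` even, and let `χ` be the quartic residue character
modulo the Gaussian prime `α + x i`. Counting points with characters writes the trace of Frobenius
of `y² = x³ + D x` through `χ(-D)` and the Jacobi sum `J(χ, χ²)` (`frobTrace_eq_jacobi`). That sum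
lies in the prime `α + x i`, has norm `p` and is `≡ -1 (mod 2 + 2 i)`, so it equals
`-(-1) ^ (x / 2) (α + x i)` (`quartJacobi_eq`). Hence the trace is `2 α` or `-2 α` exactly when the
fourth root of unity `q = (-1) ^ (x / 2) χ(-D)` is `1` or `-1` (`frobTrace_eq_iff`).

The symbol `q` depends only on the residue of `x` modulo `8 ∏ l`, the product being over the odd
primes `l ∣ D`. Indeed `χ(-1) = (-1) ^ (x / 2)`, `χ(2) = i ^ (x / 2)` (`quartChar_two`), and for an
odd prime `l = 4 m + c` with `c = ±1` the action of Frobenius on the quartic Gauss sum in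
characteristic `l` gives `χ(c l) ≡ ((α + c x i) / (α - c x i)) ^ m` modulo a prime above `l`
(`gaussEval_quartChar_prime`).

A residue class `x ≡ k (mod M)` gives the values of a quadratic polynomial in `t`, where
`x = M t + k`. The Hardy-Littlewood conjecture gives all classes with `α² + k²` prime to `M` the
same constant, since the discriminant `-(2 M α)²` is the same for all of them. This constant is
nonzero: up to finitely many Euler factors it is that of `x² + 1`, and if that one vanished no prime
at all would have the form `x² + 1`, while `2 = 1² + 1` (`exists_class_density`). So the trace
densities exist and are the proportions of admissible residues `x` with `q = 1` and `q = -1`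
(`hasTraceDensity_of_residues`).

To count these residues, the indicator function of `q = s`, for `s = ±1`, is written as
`(1 + q² + s (q + q̄)) / 4` (`card_globSymbol_eq`). By the Chinese remainder theorem the sums of `q`
and `q²` factor into local sums (`sum_globSymbol`). At `l ∤ α` the Cayley transform
`(α + c x i) / (α - c x i)` runs once through all `4 m`-th roots of unity except `-1`
(`sum_local_of_not_dvd`), so the sum over the roots of unity vanishes unless `4` divides the
exponent `e` of `l`, and the omitted root leaves `-(-1) ^ (m e)` out of `4 m - 1 = τ(l)` residues.
At `l ∣ α` the transform is constantly `-1`. The power of `i` coming from `-1`, `2` and the Jacobi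
sum contributes a factor `0` or `1`, which separates the cases of `D` modulo powers of `2`.
-/

namespace LangTrotter

/-! ### The quartic residue character with values in the Gaussian integers -/

open GaussianInt

/-- The imaginary unit of `ℤ[i]`. -/
def gi : GaussianInt := ⟨0, 1⟩

lemma gi_mul_gi : gi * gi = -1 := rfl

lemma gi_sq : gi ^ 2 = -1 := rfl

/-- The ring homomorphism `ℤ[i] → F` that sends `i` to a given square root `f` of `-1`. -/
def gaussEval {F : Type*} [CommRing F] (f : F) (hf : f * f = -1) : GaussianInt →+* F :=
  Zsqrtd.lift ⟨f, by simpa using hf⟩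

lemma gaussEval_apply {F : Type*} [CommRing F] (f : F) (hf : f * f = -1) (z : GaussianInt) :
    gaussEval f hf z = z.re + z.im * f := rfl

lemma gaussEval_gi {F : Type*} [CommRing F] (f : F) (hf : f * f = -1) :
    gaussEval f hf gi = f := by
  simp [gaussEval_apply, gi]

open Classical in
/-- The multiplicative section of `gaussEval f` on the fourth roots of unity `±1`, `±f` of a
field: it sends `±1` to `±1` and `±f` to `±i`, and every other element to `0`. -/
noncomputable def quartLift {F : Type*} [Field F] (f : F) (y : F) : GaussianInt :=
  if y = 1 then 1 else if y = -1 then -1 else if y = f then gi else if y = -f then -gi else 0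

section quartLift

variable {F : Type*} [Field F] {f : F}

lemma eq_of_pow_four_eq_one (hf : f * f = -1) {y : F} (hy : y ^ 4 = 1) :
    y = 1 ∨ y = -1 ∨ y = f ∨ y = -f := by
  have h : (y - 1) * ((y + 1) * ((y - f) * (y + f))) = 0 := by
    linear_combination hy - (y ^ 2 - 1) * hf
  rcases mul_eq_zero.1 h with h | h
  · exact .inl (sub_eq_zero.1 h)
  rcases mul_eq_zero.1 h with h | h
  · exact .inr (.inl (eq_neg_of_add_eq_zero_left h))
  rcases mul_eq_zero.1 h with h | h
  · exact .inr (.inr (.inl (sub_eq_zero.1 h)))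
  · exact .inr (.inr (.inr (eq_neg_of_add_eq_zero_left h)))

lemma two_ne_zero_facts (hf : f * f = -1) (h2 : (2 : F) ≠ 0) :
    (-1 : F) ≠ 1 ∧ f ≠ 1 ∧ f ≠ -1 ∧ f ≠ -f ∧ f ≠ 0 := by
  have h0 : f ≠ 0 := by rintro rfl; simp at hf
  refine ⟨?_, ?_, ?_, ?_, h0⟩
  · intro h; apply h2; linear_combination -h
  · rintro rfl; apply h2; linear_combination hf
  · rintro rfl; apply h2; linear_combination hf
  · intro h
    have : 2 * f = 0 := by linear_combination h
    rcases mul_eq_zero.1 this with h | h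
    · exact h2 h
    · exact h0 h

lemma quartLift_one : quartLift f 1 = 1 := by simp [quartLift]

lemma quartLift_neg_one (hf : f * f = -1) (h2 : (2 : F) ≠ 0) : quartLift f (-1) = -1 := by
  simp [quartLift, (two_ne_zero_facts hf h2).1]

lemma quartLift_self (hf : f * f = -1) (h2 : (2 : F) ≠ 0) : quartLift f f = gi := by
  obtain ⟨h1, h3, h4, h5, h6⟩ := two_ne_zero_facts hf h2
  simp [quartLift, h3, h4]

lemma quartLift_neg_self (hf : f * f = -1) (h2 : (2 : F) ≠ 0) : quartLift f (-f) = -gi := by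
  obtain ⟨h1, h3, h4, h5, h6⟩ := two_ne_zero_facts hf h2
  have h7 : -f ≠ 1 := fun h => h4 (by linear_combination -h)
  have h8 : -f ≠ -1 := fun h => h3 (by linear_combination -h)
  simp [quartLift, h7, h3, h5.symm]

lemma quartLift_zero (hf : f * f = -1) : quartLift f 0 = 0 := by
  have h0 : f ≠ 0 := by rintro rfl; simp at hf
  simp [quartLift, h0.symm, h0]

lemma gaussEval_quartLift (hf : f * f = -1) (h2 : (2 : F) ≠ 0) {y : F} (hy : y ^ 4 = 1) :
    gaussEval f hf (quartLift f y) = y := by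
  rcases eq_of_pow_four_eq_one hf hy with rfl | rfl | rfl | rfl
  · simp [quartLift_one]
  · simp [quartLift_neg_one hf h2]
  · simp [quartLift_self hf h2, gaussEval_gi]
  · rw [quartLift_neg_self hf h2]; simp [gaussEval_gi]

/-- The units `1, -1, i, -i` of `ℤ[i]`, as elements of the ring. -/
def IsGaussUnit (z : GaussianInt) : Prop := z = 1 ∨ z = -1 ∨ z = gi ∨ z = -gi

lemma IsGaussUnit.pow_four {z : GaussianInt} (h : IsGaussUnit z) : z ^ 4 = 1 := by
  rcases h with rfl | rfl | rfl | rfl <;> rfl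

lemma IsGaussUnit.star_mul {z : GaussianInt} (h : IsGaussUnit z) : star z * z = 1 := by
  rcases h with rfl | rfl | rfl | rfl <;> rfl

lemma isGaussUnit_of_pow_four {z : GaussianInt} (h : z ^ 4 = 1) : IsGaussUnit z := by
  have h : (z - 1) * ((z + 1) * ((z - gi) * (z + gi))) = 0 := by
    linear_combination h - (z ^ 2 - 1) * gi_mul_gi
  rcases mul_eq_zero.1 h with h | h
  · exact .inl (sub_eq_zero.1 h)
  rcases mul_eq_zero.1 h with h | h
  · exact .inr (.inl (eq_neg_of_add_eq_zero_left h))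
  rcases mul_eq_zero.1 h with h | h
  · exact .inr (.inr (.inl (sub_eq_zero.1 h)))
  · exact .inr (.inr (.inr (eq_neg_of_add_eq_zero_left h)))

lemma IsGaussUnit.mul {z w : GaussianInt} (h : IsGaussUnit z) (h' : IsGaussUnit w) :
    IsGaussUnit (z * w) :=
  isGaussUnit_of_pow_four (by rw [mul_pow, h.pow_four, h'.pow_four, one_mul])

lemma isGaussUnit_quartLift (hf : f * f = -1) (h2 : (2 : F) ≠ 0) {y : F} (hy : y ^ 4 = 1) :
    IsGaussUnit (quartLift f y) := by
  rcases eq_of_pow_four_eq_one hf hy with rfl | rfl | rfl | rfl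
  · exact .inl quartLift_one
  · exact .inr (.inl (quartLift_neg_one hf h2))
  · exact .inr (.inr (.inl (quartLift_self hf h2)))
  · exact .inr (.inr (.inr (quartLift_neg_self hf h2)))

lemma quartLift_gaussEval (hf : f * f = -1) (h2 : (2 : F) ≠ 0) {z : GaussianInt}
    (hz : IsGaussUnit z) : quartLift f (gaussEval f hf z) = z := by
  rcases hz with rfl | rfl | rfl | rfl
  · simp [quartLift_one]
  · simp [quartLift_neg_one hf h2]
  · simp [quartLift_self hf h2, gaussEval_gi]
  · rw [map_neg, gaussEval_gi, quartLift_neg_self hf h2]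

lemma quartLift_eq_of_gaussEval_eq (hf : f * f = -1) (h2 : (2 : F) ≠ 0) {z : GaussianInt} {y : F}
    (hz : IsGaussUnit z) (h : gaussEval f hf z = y) : z = quartLift f y := by
  rw [← h, quartLift_gaussEval hf h2 hz]

lemma quartLift_mul (hf : f * f = -1) (h2 : (2 : F) ≠ 0) {y z : F} (hy : y ^ 4 = 1)
    (hz : z ^ 4 = 1) : quartLift f (y * z) = quartLift f y * quartLift f z := by
  refine (quartLift_eq_of_gaussEval_eq hf h2
    ((isGaussUnit_quartLift hf h2 hy).mul (isGaussUnit_quartLift hf h2 hz)) ?_).symm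
  rw [map_mul, gaussEval_quartLift hf h2 hy, gaussEval_quartLift hf h2 hz]

lemma quartLift_pow (hf : f * f = -1) (h2 : (2 : F) ≠ 0) {y : F} (hy : y ^ 4 = 1) (n : ℕ) :
    quartLift f (y ^ n) = quartLift f y ^ n := by
  induction n with
  | zero => simp [quartLift_one]
  | succ n ih =>
    rw [pow_succ, quartLift_mul hf h2 (by rw [← pow_mul, mul_comm, pow_mul, hy, one_pow]) hy, ih,
      pow_succ]

end quartLift

lemma two_ne_zero_of_mod_four {p : ℕ} [Fact p.Prime] (hp : p % 4 = 1) : (2 : ZMod p) ≠ 0 := by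
  have : ((2 : ℕ) : ZMod p) ≠ 0 := by
    rw [Ne, ZMod.natCast_eq_zero_iff]
    intro h
    have := Nat.le_of_dvd (by norm_num) h
    have := (Fact.out : p.Prime).two_le
    omega
  exact_mod_cast this

/-- The quartic residue character of `𝔽_p`, for `p ≡ 1 (mod 4)`, with values in `ℤ[i]`, attached
to the choice of a square root `f` of `-1`: it is characterised by
`χ(a) ≡ a ^ ((p - 1) / 4)` modulo the prime ideal that is the kernel of `i ↦ f`. -/
noncomputable def quartChar (p : ℕ) [Fact p.Prime] (hp : p % 4 = 1) (f : ZMod p)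
    (hf : f * f = -1) : MulChar (ZMod p) GaussianInt where
  toFun a := quartLift f (a ^ ((p - 1) / 4))
  map_one' := by simp [quartLift_one]
  map_mul' a b := by
    have h2 := two_ne_zero_of_mod_four hp
    have hk : (p - 1) / 4 ≠ 0 := by have := (Fact.out : p.Prime).two_le; omega
    have key : ∀ a : ZMod p, a ≠ 0 → (a ^ ((p - 1) / 4)) ^ 4 = 1 := fun a ha => by
      rw [← pow_mul, Nat.div_mul_cancel (by omega), ZMod.pow_card_sub_one_eq_one ha]
    by_cases ha : a = 0
    · simp [ha, zero_pow hk, quartLift_zero hf]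
    by_cases hb : b = 0
    · simp [hb, zero_pow hk, quartLift_zero hf]
    rw [mul_pow, quartLift_mul hf h2 (key a ha) (key b hb)]
  map_nonunit' a ha := by
    have hk : (p - 1) / 4 ≠ 0 := by have := (Fact.out : p.Prime).two_le; omega
    have : a = 0 := by simpa using ha
    simp [this, zero_pow hk, quartLift_zero hf]

section quartChar

variable {p : ℕ} [Fact p.Prime] (hp : p % 4 = 1) {f : ZMod p} (hf : f * f = -1)

lemma quartChar_apply (a : ZMod p) :
    quartChar p hp f hf a = quartLift f (a ^ ((p - 1) / 4)) := rfl

lemma pow_quarter_pow_four (hp : p % 4 = 1) {a : ZMod p} (ha : a ≠ 0) :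
    (a ^ ((p - 1) / 4)) ^ 4 = 1 := by
  rw [← pow_mul, Nat.div_mul_cancel (by omega), ZMod.pow_card_sub_one_eq_one ha]

lemma gaussEval_quartChar (a : ZMod p) :
    gaussEval f hf (quartChar p hp f hf a) = a ^ ((p - 1) / 4) := by
  by_cases ha : a = 0
  · have hk : (p - 1) / 4 ≠ 0 := by have := (Fact.out : p.Prime).two_le; omega
    rw [quartChar_apply, ha, zero_pow hk, quartLift_zero hf, map_zero]
  · exact gaussEval_quartLift hf (two_ne_zero_of_mod_four hp) (pow_quarter_pow_four hp ha)

lemma isGaussUnit_quartChar {a : ZMod p} (ha : a ≠ 0) : IsGaussUnit (quartChar p hp f hf a) :=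
  isGaussUnit_quartLift hf (two_ne_zero_of_mod_four hp) (pow_quarter_pow_four hp ha)

lemma quartChar_pow_four : quartChar p hp f hf ^ 4 = 1 := by
  refine MulChar.ext fun a => ?_
  rw [MulChar.pow_apply_coe, (isGaussUnit_quartChar hp hf a.ne_zero).pow_four,
    MulChar.one_apply_coe]

/-- The square of the quartic character is the quadratic character. -/
lemma quartChar_sq (a : ZMod p) :
    quartChar p hp f hf a ^ 2 = ((quadraticChar (ZMod p) a : ℤ) : GaussianInt) := by
  have h2 := two_ne_zero_of_mod_four hp
  by_cases ha : a = 0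
  · simp [ha, MulChar.map_zero]
  have h : a ^ (p / 2) = (quadraticChar (ZMod p) a : ZMod p) := by
    have := legendreSym.eq_pow p (a.val : ℤ)
    simpa [legendreSym] using this.symm
  have hu := isGaussUnit_quartChar hp hf ha
  have e : gaussEval f hf (quartChar p hp f hf a ^ 2)
      = gaussEval f hf ((quadraticChar (ZMod p) a : ℤ) : GaussianInt) := by
    rw [map_pow, gaussEval_quartChar, map_intCast, ← h, ← pow_mul]
    congr 1
    omega
  have hq : IsGaussUnit ((quadraticChar (ZMod p) a : ℤ) : GaussianInt) := by
    rcases quadraticChar_dichotomy ha with h | h <;> rw [h]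
    · exact .inl (by simp)
    · exact .inr (.inl (by simp))
  rw [quartLift_eq_of_gaussEval_eq hf h2 ((pow_two (quartChar p hp f hf a)) ▸ hu.mul hu) e,
    quartLift_gaussEval hf h2 hq]

lemma quartChar_sq_ne_one : quartChar p hp f hf ^ 2 ≠ 1 := by
  intro h
  have h2 := two_ne_zero_of_mod_four hp
  obtain ⟨a, ha⟩ := quadraticChar_exists_neg_one (F := ZMod p)
    (by rw [ZMod.ringChar_zmod_n]; rintro rfl; simp at hp)
  have ha0 : a ≠ 0 := by rintro rfl; simp at ha
  have := quartChar_sq hp hf a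
  rw [ha] at this
  have h1 : (quartChar p hp f hf ^ 2) a = 1 := by
    rw [h, MulChar.one_apply ha0.isUnit]
  rw [MulChar.pow_apply' _ two_ne_zero, this] at h1
  exact absurd (congrArg Zsqrtd.re h1) (by decide)

lemma quartChar_ne_one : quartChar p hp f hf ≠ 1 := fun h =>
  quartChar_sq_ne_one hp hf (by rw [h, one_pow])

lemma quartChar_pow_three_ne_one : quartChar p hp f hf ^ 3 ≠ 1 := fun h =>
  quartChar_ne_one hp hf (by
    have := quartChar_pow_four hp hf
    rwa [pow_succ, h, one_mul] at this)

lemma quartChar_inv : (quartChar p hp f hf)⁻¹ = quartChar p hp f hf ^ 3 :=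
  inv_eq_of_mul_eq_one_right (by rw [← pow_succ', quartChar_pow_four])

lemma quartChar_star (a : ZMod p) :
    (quartChar p hp f hf ^ 3) a = star (quartChar p hp f hf a) := by
  rw [MulChar.pow_apply' _ three_ne_zero]
  by_cases ha : a = 0
  · simp [ha, MulChar.map_zero]
  · rcases isGaussUnit_quartChar hp hf ha with h | h | h | h <;> rw [h] <;> rfl

end quartChar

/-! ### The Jacobi sum of the quartic character -/

lemma sum_eval_eq_zero_of_natDegree_lt {p : ℕ} [Fact p.Prime] (P : Polynomial (ZMod p))
    (hP : P.natDegree < p - 1) : ∑ a : ZMod p, P.eval a = 0 := by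
  simp_rw [Polynomial.eval_eq_sum_range]
  rw [Finset.sum_comm]
  refine Finset.sum_eq_zero fun i hi => ?_
  rw [← Finset.mul_sum, FiniteField.sum_pow_lt_card_sub_one, mul_zero]
  rw [ZMod.card]
  have := Finset.mem_range.1 hi
  omega

section jacobi

variable {p : ℕ} [Fact p.Prime] (hp : p % 4 = 1) {f : ZMod p} (hf : f * f = -1)

/-- The Jacobi sum `J(χ, χ²)` of the quartic character. -/
noncomputable def quartJacobi (p : ℕ) [Fact p.Prime] (hp : p % 4 = 1) (f : ZMod p)
    (hf : f * f = -1) : GaussianInt :=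
  jacobiSum (quartChar p hp f hf) (quartChar p hp f hf ^ 2)

/-- The Jacobi sum lies in the prime above `p` that defines `χ`: modulo that prime it is the sum
over `𝔽_p` of the values of a polynomial of degree less than `p - 1`. -/
lemma gaussEval_quartJacobi : gaussEval f hf (quartJacobi p hp f hf) = 0 := by
  set k := (p - 1) / 4 with hk
  have hp2 := (Fact.out : p.Prime).two_le
  have key : gaussEval f hf (quartJacobi p hp f hf)
      = ∑ a : ZMod p, 
        (Polynomial.X ^ k * (1 - Polynomial.X) ^ (2 * k) : Polynomial (ZMod p)).eval a := by
    rw [quartJacobi, jacobiSum, map_sum]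
    refine Finset.sum_congr rfl fun a _ => ?_
    rw [map_mul, MulChar.pow_apply' _ two_ne_zero, map_pow, gaussEval_quartChar,
      gaussEval_quartChar, ← hk, ← pow_mul, mul_comm k 2]
    simp
  rw [key]
  refine sum_eval_eq_zero_of_natDegree_lt _ (lt_of_le_of_lt (b := k + 2 * k) ?_ ?_)
  · refine Polynomial.natDegree_mul_le.trans (add_le_add (by simp) ?_)
    refine Polynomial.natDegree_pow_le.trans ?_
    have : (1 - Polynomial.X : Polynomial (ZMod p)).natDegree ≤ 1 := by
      refine (Polynomial.natDegree_sub_le _ _).trans ?_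
      simp
    nlinarith
  · have h5 : 5 ≤ p := by
      rcases Nat.lt_or_ge p 5 with h | h
      · interval_cases p <;> omega
      · exact h
    omega

lemma star_quartJacobi :
    jacobiSum (quartChar p hp f hf ^ 3) (quartChar p hp f hf ^ 2)
      = star (quartJacobi p hp f hf) := by
  rw [quartJacobi, jacobiSum, jacobiSum, star_sum]
  refine Finset.sum_congr rfl fun a _ => ?_
  rw [star_mul', quartChar_star, MulChar.pow_apply' _ two_ne_zero, quartChar_sq]
  congr 1

lemma quartJacobi_mul_star :
    quartJacobi p hp f hf * star (quartJacobi p hp f hf) = (p : GaussianInt) := by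
  set χ := quartChar p hp f hf with hχ
  have h4 : χ ^ 4 = 1 := quartChar_pow_four hp hf
  have inj := GaussianInt.toComplex_injective
  apply inj
  have h := jacobiSum_mul_jacobiSum_inv (F := ZMod p) (F' := ℂ)
    (χ := χ.ringHomComp GaussianInt.toComplex) (φ := (χ ^ 2).ringHomComp GaussianInt.toComplex)
    (by rw [ZMod.ringChar_zmod_n, ringChar.eq_zero]; exact (Fact.out : p.Prime).ne_zero.symm)
    ((MulChar.ringHomComp_ne_one_iff inj).2 (quartChar_ne_one hp hf))
    ((MulChar.ringHomComp_ne_one_iff inj).2 (quartChar_sq_ne_one hp hf))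
    (by
      rw [← MulChar.ringHomComp_mul, ← pow_succ']
      exact (MulChar.ringHomComp_ne_one_iff inj).2 (quartChar_pow_three_ne_one hp hf))
  have hi2 : (χ ^ 2)⁻¹ = χ ^ 2 := inv_eq_of_mul_eq_one_right (by rw [← pow_add, h4])
  rw [MulChar.ringHomComp_inv, MulChar.ringHomComp_inv, hi2, quartChar_inv,
    jacobiSum_ringHomComp, jacobiSum_ringHomComp, star_quartJacobi, ZMod.card] at h
  rw [map_mul, map_natCast, ← h]
  rfl

lemma norm_quartJacobi :
    (quartJacobi p hp f hf).re ^ 2 + (quartJacobi p hp f hf).im ^ 2 = p := by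
  have := congrArg Zsqrtd.re (quartJacobi_mul_star hp hf)
  simp at this
  linarith

/-- `J(χ, χ²) ≡ -1` modulo `2 + 2i`: every nonzero value of `χ` is `1` modulo `1 + i`
and every nonzero value of `χ²` is `1` modulo `2`. -/
lemma quartJacobi_congr :
    (⟨2, 2⟩ : GaussianInt) ∣ quartJacobi p hp f hf + 1 := by
  set χ := quartChar p hp f hf with hχ
  have hdiv : (⟨2, 2⟩ : GaussianInt) ∣
      ∑ a ∈ Finset.univ \ {0, 1}, (χ a - 1) * ((χ ^ 2) (1 - a) - 1) := by
    refine Finset.dvd_sum fun a ha => ?_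
    simp only [Finset.mem_sdiff, Finset.mem_univ, Finset.mem_insert, Finset.mem_singleton,
      not_or, true_and] at ha
    have h1 : (⟨1, 1⟩ : GaussianInt) ∣ χ a - 1 := by
      rcases isGaussUnit_quartChar hp hf ha.1 with h | h | h | h <;> rw [hχ, h]
      · exact ⟨0, rfl⟩
      · exact ⟨⟨-1, 1⟩, rfl⟩
      · exact ⟨⟨0, 1⟩, rfl⟩
      · exact ⟨⟨-1, 0⟩, rfl⟩
    have h2 : (2 : GaussianInt) ∣ (χ ^ 2) (1 - a) - 1 := by
      have : 1 - a ≠ 0 := sub_ne_zero.2 (Ne.symm ha.2)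
      rw [MulChar.pow_apply' _ two_ne_zero, hχ]
      rcases isGaussUnit_quartChar hp hf this with h | h | h | h <;> rw [h]
      · exact ⟨0, rfl⟩
      · exact ⟨0, rfl⟩
      · exact ⟨-1, rfl⟩
      · exact ⟨-1, rfl⟩
    have := mul_dvd_mul h1 h2
    exact this
  have hsum : ∑ a ∈ Finset.univ \ {0, 1}, (χ a - 1) * ((χ ^ 2) (1 - a) - 1)
      = quartJacobi p hp f hf + p := by
    have e1 : ∑ a ∈ (Finset.univ : Finset (ZMod p)) \ {0, 1}, χ a = -1 := by
      have := Finset.sum_sdiff (f := χ) (Finset.subset_univ ({0, 1} : Finset (ZMod p)))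
      rw [MulChar.sum_eq_zero_of_ne_one (quartChar_ne_one hp hf),
        Finset.sum_pair zero_ne_one, MulChar.map_zero, map_one, zero_add] at this
      exact eq_neg_of_add_eq_zero_left this
    have e2 : ∑ a ∈ (Finset.univ : Finset (ZMod p)) \ {0, 1}, (χ ^ 2) (1 - a) = -1 := by
      have := Finset.sum_sdiff (f := fun a => (χ ^ 2) (1 - a))
        (Finset.subset_univ ({0, 1} : Finset (ZMod p)))
      rw [Fintype.sum_equiv (Equiv.subLeft (1 : ZMod p)) (fun a => (χ ^ 2) (1 - a))
          (fun a => (χ ^ 2) a) (fun a => rfl),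
        MulChar.sum_eq_zero_of_ne_one (quartChar_sq_ne_one hp hf),
        Finset.sum_pair zero_ne_one, sub_self, MulChar.map_zero, sub_zero, map_one,
        add_zero] at this
      exact eq_neg_of_add_eq_zero_left this
    have e3 : ∑ a ∈ (Finset.univ : Finset (ZMod p)) \ {0, 1}, (1 : GaussianInt) = p - 2 := by
      have := Finset.sum_sdiff (f := fun _ => (1 : GaussianInt))
        (Finset.subset_univ ({0, 1} : Finset (ZMod p)))
      rw [Finset.sum_pair zero_ne_one] at this
      simp only [Finset.sum_const, Finset.card_univ, ZMod.card, nsmul_eq_mul, mul_one] at this ⊢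
      linear_combination this
    have e4 := jacobiSum_eq_sum_sdiff χ (χ ^ 2)
    rw [quartJacobi, ← hχ, e4]
    simp_rw [sub_mul, mul_sub, Finset.sum_sub_distrib, mul_one, one_mul]
    rw [e1, e2, e3]
    ring
  rw [hsum] at hdiv
  have hp1 : (⟨2, 2⟩ : GaussianInt) ∣ (p : GaussianInt) - 1 := by
    obtain ⟨k, hk⟩ : ∃ k, p = 4 * k + 1 := ⟨p / 4, by omega⟩
    rw [hk]
    push_cast
    exact ⟨⟨1, -1⟩ * k, by rw [← mul_assoc, add_sub_cancel_right]; rfl⟩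
  have := dvd_sub hdiv hp1
  convert this using 1
  ring

/-- For `p = α² + x²` with `α ≡ 1 (mod 4)` and `x` even, the Jacobi sum of the quartic character
modulo `α + x i` is `-(-1) ^ (x / 2) (α + x i)`. -/
lemma quartJacobi_eq {α y : ℤ} (hα : α % 4 = 1) (hpx : (p : ℤ) = α ^ 2 + (2 * y) ^ 2)
    (hfx : (α : ZMod p) + (2 * y : ℤ) * f = 0) :
    quartJacobi p hp f hf = -((-1) ^ y.natAbs * ⟨α, 2 * y⟩) := by
  set J := quartJacobi p hp f hf with hJ
  obtain ⟨⟨c, d⟩, hcd⟩ := quartJacobi_congr hp hf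
  have hre : J.re = 2 * c - 2 * d - 1 := by
    have := congrArg Zsqrtd.re hcd
    simp at this
    linarith
  have him : J.im = 2 * d + 2 * c := by
    have := congrArg Zsqrtd.im hcd
    simp at this
    linarith
  have hN := norm_quartJacobi hp hf
  rw [← hJ] at hN
  have hφ := gaussEval_quartJacobi hp hf
  rw [← hJ, gaussEval_apply] at hφ
  have hpp : (0 : ℤ) < p := by exact_mod_cast (Fact.out : p.Prime).pos
  -- the imaginary part of `J (α - 2 y i)`, up to sign, is a multiple `p t`, and that number has
  -- norm `p ^ 2`; so `|t| ≤ 1`, and `t` is even by the congruence, so `t = 0`, `J = ±(α + 2 y i)`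
  have hdvd : (p : ℤ) ∣ J.re * (2 * y) - J.im * α := by
    rw [← ZMod.intCast_zmod_eq_zero_iff_dvd]
    push_cast
    push_cast at hfx
    linear_combination (2 * y : ZMod p) * hφ - (J.im : ZMod p) * hfx
  obtain ⟨t, ht⟩ := hdvd
  have hid : (J.re * (2 * y) - J.im * α) ^ 2 + (J.re * α + J.im * (2 * y)) ^ 2 = (p : ℤ) ^ 2 := by
    linear_combination (p : ℤ) * hN + (J.re ^ 2 + J.im ^ 2) * (-hpx)
  have ht0 : t = 0 := by
    have h1 : t ^ 2 ≤ 1 := by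
      rw [ht] at hid
      have : (p : ℤ) ^ 2 * t ^ 2 ≤ (p : ℤ) ^ 2 * 1 := by
        nlinarith [sq_nonneg (J.re * α + J.im * (2 * y))]
      exact le_of_mul_le_mul_left this (by positivity)
    have h2 : t % 2 = 0 := by
      have e : (J.re * (2 * y) - J.im * α) = 2 * (J.re * y - (d + c) * α) := by rw [him]; ring
      rw [e] at ht
      have hp2 : (p : ℤ) % 2 = 1 := by omega
      have : ((p : ℤ) * t) % 2 = 0 := by omega
      rw [Int.mul_emod, hp2] at this
      omega
    have : -1 ≤ t := by nlinarith
    have : t ≤ 1 := by nlinarith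
    omega
  rw [ht0, mul_zero] at ht
  have h0 : J.re * α + J.im * (2 * y) = p ∨ J.re * α + J.im * (2 * y) = -p := by
    rw [ht] at hid
    exact sq_eq_sq_iff_eq_or_eq_neg.1 (by linarith)
  have hy : ((-1 : GaussianInt) ^ y.natAbs = 1 ∧ y % 2 = 0) ∨
      ((-1 : GaussianInt) ^ y.natAbs = -1 ∧ y % 2 = 1) := by
    rcases Nat.even_or_odd y.natAbs with h | h
    · exact .inl ⟨h.neg_one_pow, Int.even_iff.1 (Int.natAbs_even.1 h)⟩
    · exact .inr ⟨h.neg_one_pow, Int.odd_iff.1 (Int.natAbs_odd.1 h)⟩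
  have hsol : (J.re = α ∧ J.im = 2 * y) ∨ (J.re = -α ∧ J.im = -(2 * y)) := by
    rcases h0 with h | h
    · left
      constructor
      · apply mul_left_cancel₀ hpp.ne'
        linear_combination J.re * hpx + α * h + (2 * y) * ht
      · apply mul_left_cancel₀ hpp.ne'
        linear_combination J.im * hpx + (2 * y) * h - α * ht
    · right
      constructor
      · apply mul_left_cancel₀ hpp.ne'
        linear_combination J.re * hpx + α * h + (2 * y) * ht
      · apply mul_left_cancel₀ hpp.ne'
        linear_combination J.im * hpx + (2 * y) * h - α * ht
  -- the congruence `J ≡ -1` modulo `2 + 2 i` decides the sign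
  rcases hy with ⟨h1, h2⟩ | ⟨h1, h2⟩ <;> rcases hsol with ⟨h3, h4⟩ | ⟨h3, h4⟩
  · omega
  · rw [h1, one_mul]
    exact Zsqrtd.ext (by simpa using h3) (by simpa using h4)
  · rw [h1, neg_one_mul, neg_neg]
    exact Zsqrtd.ext h3 h4
  · omega

end jacobi

/-! ### The trace of Frobenius as a Jacobi sum -/

/-- Summing a function over all squares, with multiplicity. -/
lemma sum_comp_sq {p : ℕ} [Fact p.Prime] (hp2 : p ≠ 2) {R : Type*} [CommRing R]
    (h : ZMod p → R) :
    ∑ t : ZMod p, h (t ^ 2) = ∑ y : ZMod p, (((quadraticChar (ZMod p) y : ℤ) : R) + 1) * h y := by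
  rw [← Finset.sum_fiberwise (s := Finset.univ) (g := fun t : ZMod p => t ^ 2)]
  refine Finset.sum_congr rfl fun y _ => ?_
  have hc := quadraticChar_card_sqrts (F := ZMod p) (by rwa [ZMod.ringChar_zmod_n]) y
  rw [Finset.sum_congr rfl (g := fun _ => h y)
    (fun t ht => by rw [(Finset.mem_filter.1 ht).2]), Finset.sum_const, nsmul_eq_mul]
  congr 1
  have : (Finset.univ.filter (fun t : ZMod p => t ^ 2 = y)) =
      {t : ZMod p | t ^ 2 = y}.toFinset := by
    ext; simp
  rw [this, ← Int.cast_natCast, hc]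
  push_cast
  rfl

/-- The trace of Frobenius of `y ^ 2 = x ^ 3 + D x` as a character sum. -/
lemma frobTrace_eq_neg_sum (D : ℤ) {p : ℕ} [Fact p.Prime] (hp2 : p ≠ 2)
    (hgood : ¬ (p : ℤ) ∣ (curveE D).Δ) :
    frobTrace D p = -∑ t : ZMod p, quadraticChar (ZMod p) (t ^ 3 + D * t) := by
  set W := ((curveE D).map (Int.castRingHom (ZMod p))).toAffine with hW
  have hΔ : W.Δ ≠ 0 := by
    rw [hW, WeierstrassCurve.map_Δ]
    simpa [ZMod.intCast_zmod_eq_zero_iff_dvd] using hgood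
  have hns : ∀ q : ZMod p × ZMod p,
      W.Nonsingular q.1 q.2 ↔ q.2 ^ 2 = q.1 ^ 3 + D * q.1 := fun q => by
    rw [← W.equation_iff_nonsingular_of_Δ_ne_zero hΔ, WeierstrassCurve.Affine.equation_iff]
    simp [hW, curveE, WeierstrassCurve.map]
  have e1 : Nat.card W.Point
      = Nat.card {q : ZMod p × ZMod p // q.2 ^ 2 = q.1 ^ 3 + D * q.1} + 1 := by
    rw [Nat.card_congr (WeierstrassCurve.Affine.nonsingularPointEquiv (W' := W))]
    rw [Nat.card_congr (Equiv.subtypeEquivRight hns).symm]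
    exact Finite.card_option
  have e2 : (Nat.card {q : ZMod p × ZMod p // q.2 ^ 2 = q.1 ^ 3 + D * q.1} : ℤ)
      = ∑ t : ZMod p, (quadraticChar (ZMod p) (t ^ 3 + D * t) + 1) := by
    rw [Nat.card_congr (Equiv.subtypeProdEquivSigmaSubtype
      (fun t s : ZMod p => s ^ 2 = t ^ 3 + D * t)), Nat.card_sigma]
    push_cast
    refine Finset.sum_congr rfl fun t _ => ?_
    rw [← quadraticChar_card_sqrts (F := ZMod p) (by rwa [ZMod.ringChar_zmod_n]),
      Nat.card_eq_fintype_card, Set.toFinset_card]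
    rfl
  rw [frobTrace, ← hW, e1]
  push_cast
  rw [e2, Finset.sum_add_distrib]
  simp [ZMod.card]

section

variable {p : ℕ} [Fact p.Prime] (hp : p % 4 = 1) {f : ZMod p} (hf : f * f = -1)

/-- The substitution `a = -D z` in the sum `∑ ψ(a) χ²(a + D)`. -/
lemma sum_shift_eq_jacobi (ψ : MulChar (ZMod p) GaussianInt) {D : ZMod p} (hD : D ≠ 0)
    (φ : MulChar (ZMod p) GaussianInt) :
    ∑ a : ZMod p, ψ a * φ (a + D) = ψ (-D) * φ D * jacobiSum ψ φ := by
  rw [jacobiSum, Finset.mul_sum]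
  refine (Fintype.sum_equiv (Equiv.mulLeft₀ (-D) (neg_ne_zero.2 hD)) _ _ fun z => ?_).symm
  have : (Equiv.mulLeft₀ (-D) (neg_ne_zero.2 hD)) z = -D * z := rfl
  rw [this, map_mul, show -D * z + D = D * (1 - z) by ring, map_mul]
  ring

lemma quartChar_neg_one_sq : quartChar p hp f hf (-1) ^ 2 = 1 := by
  rw [← map_pow, neg_one_sq, map_one]

/-- The trace of Frobenius of `y ^ 2 = x ^ 3 + D x` through the Jacobi sum of the quartic
character. -/
lemma frobTrace_eq_jacobi (D : ℤ) (hgood : ¬ (p : ℤ) ∣ (curveE D).Δ) (hD : (D : ZMod p) ≠ 0) :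
    (frobTrace D p : GaussianInt) =
      -(star (quartChar p hp f hf (-D)) * quartJacobi p hp f hf
        + quartChar p hp f hf (-D) * star (quartJacobi p hp f hf)) := by
  set χ := quartChar p hp f hf with hχ
  have hp2 : p ≠ 2 := by rintro rfl; simp at hp
  have hu := isGaussUnit_quartChar hp hf hD
  have hun := isGaussUnit_quartChar hp hf (neg_ne_zero.2 hD)
  rw [frobTrace_eq_neg_sum D hp2 hgood]
  push_cast
  congr 1
  -- with `a = t ^ 2` the summand `χ²(t) χ²(t² + D)` is `χ(a) χ²(a + D)`, and each `a` occurs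
  -- `1 + χ²(a)` times
  have e1 : ∀ t : ZMod p, ((quadraticChar (ZMod p) (t ^ 3 + D * t) : ℤ) : GaussianInt)
      = (fun a => χ a * (χ ^ 2) (a + D)) (t ^ 2) := fun t => by
    rw [← quartChar_sq hp hf, ← hχ]
    simp only
    rw [MulChar.pow_apply' _ two_ne_zero, show t ^ 3 + D * t = t * (t ^ 2 + D) by ring, map_mul,
      map_pow, mul_pow]
  rw [Finset.sum_congr rfl fun t _ => e1 t,
    sum_comp_sq hp2 (fun a => χ a * (χ ^ 2) (a + D))]
  have e2 : ∀ a : ZMod p, (((quadraticChar (ZMod p) a : ℤ) : GaussianInt) + 1)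
      * (χ a * (χ ^ 2) (a + D)) = (χ ^ 3) a * (χ ^ 2) (a + D) + χ a * (χ ^ 2) (a + D) := fun a => by
    rw [← quartChar_sq hp hf, ← hχ, MulChar.pow_apply' _ three_ne_zero]
    ring
  rw [Finset.sum_congr rfl fun a _ => e2 a, Finset.sum_add_distrib, sum_shift_eq_jacobi _ hD,
    sum_shift_eq_jacobi _ hD, star_quartJacobi, ← quartJacobi]
  have e3 : (χ ^ 2) (D : ZMod p) = χ (-D) ^ 2 := by
    rw [MulChar.pow_apply' _ two_ne_zero, ← neg_one_mul (D : ZMod p), map_mul, mul_pow,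
      quartChar_neg_one_sq, one_mul]
  have h4 := hun.pow_four
  have e4 : star (χ (-D)) = χ (-D) ^ 3 := by
    have h1 := hun.star_mul
    calc star (χ (-D)) = star (χ (-D)) * χ (-D) ^ 4 := by rw [h4, mul_one]
      _ = (star (χ (-D)) * χ (-D)) * χ (-D) ^ 3 := by ring
      _ = χ (-D) ^ 3 := by rw [h1, one_mul]
  rw [e3, e4, MulChar.pow_apply' _ three_ne_zero]
  linear_combination (χ (-D) * star (quartJacobi p hp f hf)) * h4

/-- For `p = α² + x²` with `x = 2 y`, the trace of Frobenius is `± 2 α` according to the value of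
the quartic character at `-D`. -/
lemma frobTrace_eq_iff {α y : ℤ} (hα : α % 4 = 1) (hpx : (p : ℤ) = α ^ 2 + (2 * y) ^ 2)
    (hfx : (α : ZMod p) + (2 * y : ℤ) * f = 0) (D : ℤ) (hgood : ¬ (p : ℤ) ∣ (curveE D).Δ)
    (hD : (D : ZMod p) ≠ 0) :
    (frobTrace D p = 2 * α ↔ (-1) ^ y.natAbs * quartChar p hp f hf (-D) = 1) ∧
    (frobTrace D p = 2 * (-α) ↔ (-1) ^ y.natAbs * quartChar p hp f hf (-D) = -1) := by
  have h := frobTrace_eq_jacobi hp hf D hgood hD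
  rw [quartJacobi_eq hp hf hα hpx hfx] at h
  have hre := congrArg Zsqrtd.re h
  have hs : (-1 : GaussianInt) ^ y.natAbs = 1 ∨ (-1 : GaussianInt) ^ y.natAbs = -1 :=
    neg_one_pow_eq_or _ _
  have n1 : (-1 : GaussianInt) ≠ 1 := by decide
  have n2 : gi ≠ 1 := by decide
  have n3 : gi ≠ -1 := by decide
  have n4 : -gi ≠ 1 := by decide
  have n5 : -gi ≠ -1 := by decide
  rcases hs with hs | hs <;>
    rcases isGaussUnit_quartChar hp hf (neg_ne_zero.2 hD) with hc | hc | hc | hc <;>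
    rw [hs, hc] at hre <;> rw [hs, hc] <;> simp [gi] at hre <;>
    simp only [one_mul, neg_one_mul, neg_neg, n1, n1.symm, n2, n3, n4, n5, iff_true, iff_false] <;>
    constructor <;> omega

end

/-! ### The supplementary laws for `-1` and `2` -/

/-- The power `i ^ y` for an integer `y`. -/
def giPow (y : ℤ) : GaussianInt := gi ^ (y % 4).toNat

lemma gi_pow_four : gi ^ 4 = 1 := rfl

lemma gi_pow_mod (k : ℕ) : gi ^ k = gi ^ (k % 4) := by
  conv_lhs => rw [← Nat.div_add_mod k 4, pow_add, pow_mul, gi_pow_four, one_pow, one_mul]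

lemma isGaussUnit_giPow (y : ℤ) : IsGaussUnit (giPow y) :=
  isGaussUnit_of_pow_four (by rw [giPow, ← pow_mul, mul_comm, pow_mul, gi_pow_four, one_pow])

lemma neg_one_pow_natAbs_eq (y : ℤ) : (-1 : GaussianInt) ^ y.natAbs = giPow y ^ 2 := by
  have h : y % 4 = 0 ∨ y % 4 = 1 ∨ y % 4 = 2 ∨ y % 4 = 3 := by omega
  rcases h with h | h | h | h <;> rw [giPow, h]
  · rw [Even.neg_one_pow (Int.natAbs_even.2 (Int.even_iff.2 (by omega)))]; rfl
  · rw [Odd.neg_one_pow (Int.natAbs_odd.2 (Int.odd_iff.2 (by omega)))]; rfl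
  · rw [Even.neg_one_pow (Int.natAbs_even.2 (Int.even_iff.2 (by omega)))]; rfl
  · rw [Odd.neg_one_pow (Int.natAbs_odd.2 (Int.odd_iff.2 (by omega)))]; rfl

section

variable {p : ℕ} [Fact p.Prime] (hp : p % 4 = 1) {f : ZMod p} (hf : f * f = -1)

lemma quarter_eq {α y : ℤ} (j : ℤ) (hj : α = 4 * j + 1)
    (hpx : (p : ℤ) = α ^ 2 + (2 * y) ^ 2) :
    (((p - 1) / 4 : ℕ) : ℤ) = 4 * j ^ 2 + 2 * j + y ^ 2 := by
  have h1 := (Fact.out : p.Prime).one_le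
  have : (p : ℤ) = 4 * (4 * j ^ 2 + 2 * j + y ^ 2) + 1 := by rw [hpx, hj]; ring
  push_cast [h1]
  omega

lemma quartChar_neg_one {α y : ℤ} (hα : α % 4 = 1) (hpx : (p : ℤ) = α ^ 2 + (2 * y) ^ 2) :
    quartChar p hp f hf (-1) = giPow y ^ 2 := by
  have h2 := two_ne_zero_of_mod_four hp
  have hk := quarter_eq (p := p) (α / 4) (by omega) hpx
  set k := (p - 1) / 4 with hkd
  rw [← neg_one_pow_natAbs_eq, quartChar_apply, ← hkd]
  have hpar : Even k ↔ Even y.natAbs := by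
    rw [← Int.even_coe_nat, hk, Int.natAbs_even]
    have : Even (4 * (α / 4) ^ 2 + 2 * (α / 4)) := ⟨2 * (α / 4) ^ 2 + (α / 4), by ring⟩
    rw [Int.even_add, Int.even_pow' two_ne_zero]
    simp [this]
  rcases Nat.even_or_odd k with h | h
  · rw [h.neg_one_pow, (hpar.1 h).neg_one_pow, quartLift_one]
  · have h' : Odd y.natAbs := by
      rw [← Nat.not_even_iff_odd] at h ⊢
      rwa [← hpar]
    rw [h.neg_one_pow, h'.neg_one_pow, quartLift_neg_one hf h2]

lemma quartChar_self : quartChar p hp f hf f = gi ^ ((p - 1) / 4) := by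
  have h2 := two_ne_zero_of_mod_four hp
  rw [quartChar_apply, quartLift_pow hf h2 (by linear_combination (f * f - 1) * hf),
    quartLift_self hf h2]

lemma jacobiSym_natAbs_left {p : ℕ} (hp : p % 4 = 1) (a : ℤ) :
    jacobiSym a.natAbs p = jacobiSym a p := by
  rcases Int.natAbs_eq a with h | h
  · rw [← h]
  · conv_rhs => rw [h]
    rw [jacobiSym.neg _ (Nat.odd_iff.2 (by omega)), ZMod.χ₄_nat_one_mod_four hp, one_mul]

lemma quartChar_sq_eq_jacobiSym (a : ℤ) :
    quartChar p hp f hf a ^ 2 = ((jacobiSym a p : ℤ) : GaussianInt) := by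
  rw [quartChar_sq, ← jacobiSym.legendreSym.to_jacobiSym, legendreSym]

lemma gcd_eq_one_of_prime_sum {α x : ℤ} (hpx : (p : ℤ) = α ^ 2 + x ^ 2) : Int.gcd α x = 1 := by
  have hpr : p.Prime := Fact.out
  have h1 : ((Int.gcd α x * Int.gcd α x : ℕ) : ℤ) ∣ (p : ℤ) := by
    rw [hpx]
    push_cast
    exact dvd_add (by rw [pow_two]; exact mul_dvd_mul (Int.gcd_dvd_left ..) (Int.gcd_dvd_left ..))
      (by rw [pow_two]; exact mul_dvd_mul (Int.gcd_dvd_right ..) (Int.gcd_dvd_right ..))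
  have h2 : Int.gcd α x * Int.gcd α x ∣ p := by exact_mod_cast h1
  by_contra hne
  rcases (Nat.dvd_prime hpr).1 h2 with h | h
  · exact hne (Nat.eq_one_of_mul_eq_one_left h)
  · exact Nat.not_prime_mul hne hne (h ▸ hpr)

lemma jacobiSym_eq_one_of_sq {a c b : ℤ} (h : b ∣ a - c ^ 2) (hc : IsCoprime c b) :
    jacobiSym a b.natAbs = 1 := by
  have hg : c.gcd (b.natAbs : ℤ) = 1 := by
    rw [← Int.isCoprime_iff_gcd_eq_one]
    rcases Int.natAbs_eq b with h | h
    · rwa [← h]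
    · rw [h] at hc
      simpa using hc.neg_right
  rw [jacobiSym.mod_left' (a₂ := c ^ 2), jacobiSym.sq_one' hg]
  rw [Int.emod_eq_emod_iff_emod_sub_eq_zero]
  exact Int.emod_eq_zero_of_dvd (Int.natAbs_dvd.2 h)

/-- The quartic character of `2` at `α + 2 y i` is `i ^ y`. The proof is Dirichlet's: modulo `p`
one has `(α + x)² ≡ 2 α x`, while `2 p = (α + x)² + (α - x)²` determines the quadratic character
of `α + x`. -/
lemma quartChar_two {α y : ℤ} (hα : α % 4 = 1) (hpx : (p : ℤ) = α ^ 2 + (2 * y) ^ 2)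
    (hfx : (α : ZMod p) + (2 * y : ℤ) * f = 0) :
    quartChar p hp f hf 2 = giPow y := by
  set χ := quartChar p hp f hf with hχ
  have hpr : p.Prime := Fact.out
  have hcop : IsCoprime α (2 * y) := Int.isCoprime_iff_gcd_eq_one.2 (gcd_eq_one_of_prime_sum hpx)
  have hαodd : Odd α.natAbs := Int.natAbs_odd.2 (Int.odd_iff.2 (by omega))
  have hnodd : Odd (α + 2 * y).natAbs := Int.natAbs_odd.2 (Int.odd_iff.2 (by omega))
  -- the quadratic character of `α` is trivial
  have hκα : jacobiSym α p = 1 := by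
    rw [← jacobiSym_natAbs_left hp, jacobiSym.quadratic_reciprocity_one_mod_four' hαodd hp]
    exact jacobiSym_eq_one_of_sq (c := 2 * y) ⟨α, by rw [hpx]; ring⟩ hcop.symm
  -- the quadratic character of `α + 2 y` is that of `2` modulo `α + 2 y`
  have hκ : jacobiSym (α + 2 * y) p = ZMod.χ₈ ((α + 2 * y).natAbs : ℕ) := by
    rw [← jacobiSym_natAbs_left hp, jacobiSym.quadratic_reciprocity_one_mod_four' hnodd hp,
      ← jacobiSym.at_two hnodd]
    have h2 : IsCoprime (2 : ℤ) (α + 2 * y) := by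
      rw [Int.isCoprime_iff_gcd_eq_one]
      exact (Int.isCoprime_iff_gcd_eq_one.1 (Int.isCoprime_two_left.2 (Int.odd_iff.2 (by omega))))
    have hc : IsCoprime (α - 2 * y) (α + 2 * y) := by
      have h3 : IsCoprime (2 * α) (α + 2 * y) := by
        refine IsCoprime.mul_left h2 ?_
        have := IsCoprime.add_mul_left_right hcop 1
        rwa [mul_one, add_comm] at this
      have := IsCoprime.add_mul_right_left h3 (-1)
      rwa [show 2 * α + -1 * (α + 2 * y) = α - 2 * y by ring] at this
    have h1 : jacobiSym (2 * p) (α + 2 * y).natAbs = 1 :=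
      jacobiSym_eq_one_of_sq (c := α - 2 * y) ⟨α + 2 * y, by rw [hpx]; ring⟩ hc
    have h4 : jacobiSym 2 (α + 2 * y).natAbs ^ 2 = 1 := by
      apply jacobiSym.sq_one
      rw [← Int.isCoprime_iff_gcd_eq_one]
      rcases Int.natAbs_eq (α + 2 * y) with h | h
      · rwa [← h]
      · rw [h] at h2
        simpa using h2.neg_right
    rw [jacobiSym.mul_left] at h1
    linear_combination jacobiSym 2 (α + 2 * y).natAbs * h1 - jacobiSym p (α + 2 * y).natAbs * h4
  -- `χ` of this identity expresses `χ(2)` by the quadratic characters above and `χ(f)`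
  have hsq : ((α + 2 * y : ℤ) : ZMod p) ^ 2 = 2 * (α : ZMod p) ^ 2 * f := by
    have h1 : ((2 * y : ℤ) : ZMod p) = α * f := by
      linear_combination -f * hfx + ((2 * y : ℤ) : ZMod p) * hf
    have h2 : (α + 2 * y : ℤ) = α + (2 * y : ℤ) := rfl
    rw [Int.cast_add, h1]
    linear_combination (α : ZMod p) ^ 2 * hf
  have e := congrArg χ hsq
  rw [map_pow, map_mul, map_mul, map_pow, hχ, quartChar_sq_eq_jacobiSym, quartChar_sq_eq_jacobiSym,
    hκα, quartChar_self, hκ] at e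
  have hk := quarter_eq (p := p) (α / 4) (by omega) hpx
  rw [gi_pow_mod] at e
  set k := (p - 1) / 4
  -- this exponent of `i` and the symbol `χ₈` of `α + 2 y` depend only on `y` modulo `4` and `α`
  -- modulo `8`
  have hkm : k % 4 = (2 * (α / 4 % 2) + y % 2).toNat := by
    have h1 : y ^ 2 = 4 * ((y / 2) ^ 2 + (y / 2) * (y % 2)) + (y % 2) ^ 2 := by
      conv_lhs => rw [← Int.mul_ediv_add_emod y 2]
      ring
    have h2 : (y % 2) ^ 2 = y % 2 := by
      rcases Int.emod_two_eq y with h | h <;> rw [h] <;> rfl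
    omega
  have hval : ∀ n m : ℕ, ∀ z : GaussianInt, n % 8 = 1 ∨ n % 8 = 7 → gi ^ m * z = 1 →
      ((ZMod.χ₈ (n : ℕ) : ℤ) : GaussianInt) = χ 2 * ((1 : ℤ) : GaussianInt) ^ 2 * gi ^ m →
      χ 2 = z := by
    intro n m z hn hz h
    rw [ZMod.χ₈_nat_eq_if_mod_eight, if_neg (by omega), if_pos hn] at h
    push_cast at h
    linear_combination -z * h - χ 2 * hz
  have hval' : ∀ n m : ℕ, ∀ z : GaussianInt, n % 8 = 3 ∨ n % 8 = 5 → gi ^ m * z = -1 →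
      ((ZMod.χ₈ (n : ℕ) : ℤ) : GaussianInt) = χ 2 * ((1 : ℤ) : GaussianInt) ^ 2 * gi ^ m →
      χ 2 = z := by
    intro n m z hn hz h
    rw [ZMod.χ₈_nat_eq_if_mod_eight, if_neg (by omega), if_neg (by omega)] at h
    push_cast at h
    linear_combination z * h + χ 2 * hz
  have e' : ((ZMod.χ₈ ((α + 2 * y).natAbs : ℕ) : ℤ) : GaussianInt)
      = χ 2 * ((1 : ℤ) : GaussianInt) ^ 2 * gi ^ (k % 4) := by
    rw [e]; push_cast; ring
  have hy : y % 4 = 0 ∨ y % 4 = 1 ∨ y % 4 = 2 ∨ y % 4 = 3 := by omega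
  have hj : α / 4 % 2 = 0 ∨ α / 4 % 2 = 1 := by omega
  rw [giPow]
  rcases hy with hy | hy | hy | hy <;> rcases hj with hj | hj <;>
    rw [hkm, hj] at e' <;> rw [hy] <;>
    first
      | rw [show y % 2 = 0 by omega] at e'
        first
          | exact hval _ _ _ (by omega) rfl e'
          | exact hval' _ _ _ (by omega) rfl e'
      | rw [show y % 2 = 1 by omega] at e'
        first
          | exact hval _ _ _ (by omega) rfl e'
          | exact hval' _ _ _ (by omega) rfl e'

end

/-! ### Quartic reciprocity for rational primes, by Gauss sums -/

/-- The sign `c` with `l ≡ c (mod 4)`, for odd `l`. -/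
def sgn4 (l : ℕ) : ℤ := if l % 4 = 1 then 1 else -1

lemma sgn4_cases {l : ℕ} (hl : l % 2 = 1) :
    (sgn4 l = 1 ∧ l % 4 = 1 ∧ 4 * ((l + 1) / 4) + 1 = l) ∨
    (sgn4 l = -1 ∧ l % 4 = 3 ∧ 4 * ((l + 1) / 4) = l + 1) := by
  unfold sgn4
  split_ifs with h
  · left; omega
  · right; omega

section

variable {l : ℕ} [Fact l.Prime] {F : Type*} [Field F] [CharP F l] {I : F}

lemma sqrt_neg_one_pow {l : ℕ} {F : Type*} [Field F] {I : F} (hl : l % 2 = 1) (hI : I * I = -1) :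
    I ^ l = sgn4 l * I := by
  have h4 : I ^ 4 = 1 := by linear_combination (I * I - 1) * hI
  rcases sgn4_cases hl with ⟨h, h', h''⟩ | ⟨h, h', h''⟩
  · rw [h, ← h'', pow_succ, pow_mul, h4]; simp
  · rw [h, show l = 4 * (l / 4) + 3 by omega, pow_add, pow_mul, h4]
    push_cast
    linear_combination I * hI

lemma add_mul_sqrt_pow (hl : l % 2 = 1) (hI : I * I = -1) (a b : ℤ) :
    ((a : F) + b * I) ^ l = a + sgn4 l * b * I := by
  have : ((a : F) + b * I) ^ l = frobenius F l (a + b * I) := rfl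
  rw [this, map_add, map_mul, map_intCast, map_intCast, frobenius_def, sqrt_neg_one_pow hl hI]
  ring

variable {p : ℕ} [Fact p.Prime] (hp : p % 4 = 1) {f : ZMod p} (hf : f * f = -1)

/-- The quartic character with values in a field containing a square root `I` of `-1`. -/
noncomputable def quartCharIn (p : ℕ) [Fact p.Prime] (hp : p % 4 = 1) (f : ZMod p)
    (hf : f * f = -1) {F : Type*} [Field F] (I : F) (hI : I * I = -1) : MulChar (ZMod p) F :=
  (quartChar p hp f hf).ringHomComp (gaussEval I hI)

lemma quartCharIn_pow_four (hI : I * I = -1) : quartCharIn p hp f hf I hI ^ 4 = 1 := by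
  rw [quartCharIn, MulChar.ringHomComp_pow, quartChar_pow_four, MulChar.ringHomComp_one]

lemma quartCharIn_sq_ne_one (hI : I * I = -1) (h2 : (2 : F) ≠ 0) :
    quartCharIn p hp f hf I hI ^ 2 ≠ 1 := by
  intro h
  apply quartChar_sq_ne_one hp hf
  refine MulChar.ext fun a => ?_
  have h1 := congrArg (fun χ : MulChar (ZMod p) F => χ a) h
  simp only [quartCharIn, MulChar.ringHomComp_pow, MulChar.ringHomComp_apply,
    MulChar.one_apply_coe] at h1
  have hu : IsGaussUnit ((quartChar p hp f hf ^ 2) a) := by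
    rw [MulChar.pow_apply_coe, pow_two]
    exact (isGaussUnit_quartChar hp hf a.ne_zero).mul (isGaussUnit_quartChar hp hf a.ne_zero)
  rw [quartLift_eq_of_gaussEval_eq hI h2 hu h1, quartLift_one, MulChar.one_apply_coe]

lemma quartCharIn_neg_one_sq (hI : I * I = -1) : quartCharIn p hp f hf I hI (-1) ^ 2 = 1 := by
  rw [← map_pow, neg_one_sq, map_one]

lemma gaussSum_mul_cube (hI : I * I = -1) (h2 : (2 : F) ≠ 0) {ψ : AddChar (ZMod p) F}
    (hψ : ψ.IsPrimitive) :
    gaussSum (quartCharIn p hp f hf I hI) ψ * gaussSum (quartCharIn p hp f hf I hI ^ 3) ψ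
      = quartCharIn p hp f hf I hI (-1) * p := by
  set χ := quartCharIn p hp f hf I hI with hχ
  have h4 := quartCharIn_pow_four hp hf hI
  have hne2 := quartCharIn_sq_ne_one hp hf hI h2
  have hne : χ ≠ 1 := fun h => hne2 (by rw [← hχ, h, one_pow])
  have hinv : χ⁻¹ = χ ^ 3 := inv_eq_of_mul_eq_one_right (by rw [← pow_succ', h4])
  have h1 := gaussSum_mul_gaussSum_eq_card hne hψ
  rw [ZMod.card, hinv] at h1
  have h3 : (χ ^ 3) (-1) = χ (-1) := by
    rw [MulChar.pow_apply' _ three_ne_zero, pow_succ, quartCharIn_neg_one_sq, one_mul]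
  rw [← mul_gaussSum_inv_eq_gaussSum (χ ^ 3), h3]
  linear_combination χ (-1) * h1

/-- The fourth power of the quartic Gauss sum. -/
lemma gaussSum_pow_four (hI : I * I = -1) (h2 : (2 : F) ≠ 0) (hp0 : (p : F) ≠ 0)
    {ψ : AddChar (ZMod p) F} (hψ : ψ.IsPrimitive) :
    gaussSum (quartCharIn p hp f hf I hI) ψ ^ 4
      = gaussEval I hI (quartJacobi p hp f hf) ^ 2 * p := by
  set χ := quartCharIn p hp f hf I hI with hχ
  set J := gaussEval I hI (quartJacobi p hp f hf) with hJ
  have h4 : χ ^ 4 = 1 := quartCharIn_pow_four hp hf hI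
  have hne2 : χ ^ 2 ≠ 1 := quartCharIn_sq_ne_one hp hf hI h2
  have hinv2 : (χ ^ 2)⁻¹ = χ ^ 2 := inv_eq_of_mul_eq_one_right (by rw [← pow_add, h4])
  have hne3 : χ * χ ^ 2 ≠ 1 := fun h => hne2 (by
    have h1 : χ ^ 3 = 1 := by rw [← h, pow_succ']
    have h5 : χ = 1 := by rw [pow_succ, h1, one_mul] at h4; exact h4
    rw [h5, one_pow])
  have e1 : gaussSum (χ * χ ^ 2) ψ * J = gaussSum χ ψ * gaussSum (χ ^ 2) ψ := by
    rw [← jacobiSum_mul_nontrivial hne3 ψ, hJ, quartJacobi, ← jacobiSum_ringHomComp,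
      ← MulChar.ringHomComp_pow]
    rfl
  have e2 := gaussSum_mul_cube hp hf hI h2 hψ
  rw [← hχ, pow_succ' χ 2] at e2
  have e3 : gaussSum (χ ^ 2) ψ * gaussSum (χ ^ 2) ψ = p := by
    have h1 := gaussSum_mul_gaussSum_eq_card hne2 hψ
    rw [ZMod.card, hinv2] at h1
    have h3 : (χ ^ 2) (-1) = 1 := by
      rw [MulChar.pow_apply' _ two_ne_zero, hχ, quartCharIn_neg_one_sq]
    rw [← mul_gaussSum_inv_eq_gaussSum (χ ^ 2), h3, one_mul] at h1
    rw [← mul_gaussSum_inv_eq_gaussSum (χ ^ 2), h3, one_mul]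
    linear_combination h1
  have e5 := quartCharIn_neg_one_sq hp hf hI
  rw [← hχ] at e5
  set g := gaussSum χ ψ
  set g2 := gaussSum (χ ^ 2) ψ
  set g3 := gaussSum (χ * χ ^ 2) ψ
  set s := χ (-1)
  -- `g² g₂ = J s p`
  have e4 : g ^ 2 * g2 = J * s * p := by linear_combination -g * e1 + J * e2
  apply mul_right_cancel₀ hp0
  linear_combination (g ^ 2 * g2 + J * s * p) * e4 - g ^ 4 * e3 + J ^ 2 * p ^ 2 * e5

/-- The action of Frobenius on the quartic Gauss sum in characteristic `l ≠ p`. -/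
lemma gaussSum_frob_eq (hI : I * I = -1) (hlp : l ≠ p) (ψ : AddChar (ZMod p) F) :
    (quartCharIn p hp f hf I hI ^ l) l * gaussSum (quartCharIn p hp f hf I hI) ψ ^ l
      = gaussSum (quartCharIn p hp f hf I hI ^ l) ψ := by
  have hu : IsUnit (l : ZMod p) := by
    rw [isUnit_iff_ne_zero, Ne, ZMod.natCast_eq_zero_iff]
    intro h
    exact hlp ((Nat.prime_dvd_prime_iff_eq Fact.out Fact.out).1 h).symm
  rw [gaussSum_frob l, AddChar.pow_mulShift, ← hu.unit_spec, gaussSum_mulShift]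

/-- **Quartic reciprocity for a rational prime.** Let `p = α² + x²` and let `χ` be the quartic
character modulo `α + x i`. For an odd prime `l = 4 m + c`, `c = ±1`, one has
`χ(c l) ≡ ((α + c x i) / (α - c x i)) ^ m` in characteristic `l`. -/
theorem gaussEval_quartChar_prime (hl : l % 2 = 1) (hI : I * I = -1) (hlp : l ≠ p)
    {ψ : AddChar (ZMod p) F} (hψ : ψ.IsPrimitive)
    {α y : ℤ} (hα : α % 4 = 1) (hpx : (p : ℤ) = α ^ 2 + (2 * y) ^ 2)
    (hfx : (α : ZMod p) + (2 * y : ℤ) * f = 0) :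
    gaussEval I hI (quartChar p hp f hf ((sgn4 l * l : ℤ) : ZMod p))
      = (((α : F) + sgn4 l * (2 * y : ℤ) * I) /
          (α - sgn4 l * (2 * y : ℤ) * I)) ^ ((l + 1) / 4) := by
  have hlpr : l.Prime := Fact.out
  have h2 : (2 : F) ≠ 0 := by
    have : ((2 : ℕ) : F) ≠ 0 := by
      rw [Ne, CharP.cast_eq_zero_iff F l]
      intro h
      have := (Nat.prime_dvd_prime_iff_eq hlpr Nat.prime_two).1 h
      omega
    exact_mod_cast this
  have hp0 : (p : F) ≠ 0 := by
    rw [Ne, CharP.cast_eq_zero_iff F l]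
    intro h
    exact hlp ((Nat.prime_dvd_prime_iff_eq hlpr Fact.out).1 h)
  set u : F := (α : F) + (2 * y : ℤ) * I with hu
  set v : F := (α : F) - (2 * y : ℤ) * I with hv
  have huv : u * v = p := by
    have := congrArg (Int.cast : ℤ → F) hpx
    push_cast at this
    rw [this, hu, hv]
    push_cast
    linear_combination -(2 * y : F) ^ 2 * hI
  have hu0 : u ≠ 0 := by rintro h; rw [h, zero_mul] at huv; exact hp0 huv.symm
  have hv0 : v ≠ 0 := by rintro h; rw [h, mul_zero] at huv; exact hp0 huv.symm
  have hul : u ^ l = (α : F) + sgn4 l * (2 * y : ℤ) * I := add_mul_sqrt_pow hl hI _ _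
  set χ := quartCharIn p hp f hf I hI with hχ
  set g := gaussSum χ ψ with hg
  have hg4 : g ^ 4 = u ^ 3 * v := by
    have hs : ((-1 : F) ^ y.natAbs) ^ 2 = 1 := by rw [← pow_mul, mul_comm, pow_mul]; simp
    rw [hg, gaussSum_pow_four hp hf hI h2 hp0 hψ, quartJacobi_eq hp hf hα hpx hfx, ← huv]
    have hJ : gaussEval I hI (-((-1) ^ y.natAbs * ⟨α, 2 * y⟩)) = -((-1) ^ y.natAbs * u) := by
      rw [map_neg, map_mul, map_pow, map_neg, map_one, gaussEval_apply]
    rw [hJ]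
    linear_combination u ^ 3 * v * hs
  have hg0 : g ≠ 0 := by
    intro h
    rw [h, zero_pow four_ne_zero] at hg4
    exact mul_ne_zero (pow_ne_zero 3 hu0) hv0 hg4.symm
  have hfrob := gaussSum_frob_eq hp hf hI hlp ψ
  have hχ4 : χ ^ 4 = 1 := quartCharIn_pow_four hp hf hI
  rw [← hχ, ← hg] at hfrob
  have hgoal : gaussEval I hI (quartChar p hp f hf ((sgn4 l * l : ℤ) : ZMod p))
    = χ ((sgn4 l * l : ℤ) : ZMod p) := rfl
  rw [hgoal]
  rcases sgn4_cases hl with ⟨hc, hl4, hm⟩ | ⟨hc, hl4, hm⟩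
  -- for `l = 4 m + 1` Frobenius fixes `u` and sends `g` to `χ(l)⁻¹ g`: compare
  -- `χ(l) (u³ v) ^ m = 1` with `u ^ (4 m) = 1`
  · set m := (l + 1) / 4
    have hχl : χ ^ l = χ := by rw [← hm, pow_succ, pow_mul, hχ4, one_pow, one_mul]
    rw [hc] at hul ⊢
    push_cast at hul ⊢
    simp only [one_mul] at hul ⊢
    rw [hχl, ← hg] at hfrob
    have h1 : χ l * g ^ (4 * m) = 1 := by
      apply mul_right_cancel₀ hg0
      rw [mul_assoc, ← pow_succ, hm, hfrob, one_mul]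
    have hu4 : u ^ (4 * m) = 1 := by
      apply mul_right_cancel₀ hu0
      rw [← pow_succ, hm, hul, hu]
      push_cast; ring
    have hu' : (α : F) + 2 * y * I = u := by rw [hu]; push_cast; ring
    have hv' : (α : F) - 2 * y * I = v := by rw [hv]; push_cast; ring
    rw [hu', hv', div_pow, eq_div_iff (pow_ne_zero _ hv0)]
    rw [pow_mul, hg4, mul_pow, ← pow_mul] at h1
    have h3 : u ^ (4 * m) = u ^ (3 * m) * u ^ m := by rw [← pow_add]; congr 1; ring
    rw [h3] at hu4
    linear_combination u ^ m * h1 - χ l * v ^ m * hu4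
  -- for `l = 4 m - 1` Frobenius exchanges `u` and `v` and sends `g` to a multiple of the Gauss sum
  -- of `χ³`: compare `(u³ v) ^ m = χ(-l) p` with `u ^ (4 m) = u v = p`
  · set m := (l + 1) / 4
    have hχl : χ ^ l = χ ^ 3 := by
      rw [show l = 4 * (l / 4) + 3 by omega, pow_add, pow_mul, hχ4, one_pow, one_mul]
    rw [hc] at hul ⊢
    push_cast at hul ⊢
    simp only [neg_one_mul] at hul ⊢
    rw [hχl] at hfrob
    have hcube := gaussSum_mul_cube hp hf hI h2 hψ
    rw [← hχ, ← hg, ← hfrob] at hcube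
    have hs := quartCharIn_neg_one_sq hp hf hI
    rw [← hχ] at hs
    have hneg : χ (-(l : ZMod p)) = χ (-1) * χ l := by rw [← map_mul, neg_one_mul]
    have hl0 : χ l ^ 4 = 1 := by
      have hu : IsUnit (l : ZMod p) := by
        rw [isUnit_iff_ne_zero, Ne, ZMod.natCast_eq_zero_iff]
        intro h
        exact hlp ((Nat.prime_dvd_prime_iff_eq Fact.out Fact.out).1 h).symm
      rw [← MulChar.pow_apply' _ four_ne_zero, hχ4, MulChar.one_apply hu]
    rw [MulChar.pow_apply' _ three_ne_zero] at hcube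
    have h1 : g ^ (4 * m) = χ (-(l : ZMod p)) * p := by
      rw [hm, hneg, pow_succ]
      linear_combination χ l * hcube - g ^ l * g * hl0
    have hu4 : u ^ (4 * m) = p := by
      rw [hm, pow_succ, hul, ← huv, hv]
      push_cast; ring
    have hu' : (α : F) - -(2 * y) * I = u := by rw [hu]; push_cast; ring
    have hv' : (α : F) + -(2 * y) * I = v := by rw [hv]; push_cast; ring
    rw [hu', hv', div_pow, eq_div_iff (pow_ne_zero _ hu0)]
    rw [pow_mul, hg4, mul_pow, ← pow_mul] at h1
    have h3 : u ^ (4 * m) = u ^ (3 * m) * u ^ m := by rw [← pow_add]; congr 1; ring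
    rw [h3] at hu4
    apply mul_right_cancel₀ hp0
    linear_combination -u ^ m * h1 + v ^ m * hu4

end

/-! ### The Cayley transform and its power sums -/

section

variable {l : ℕ} [Fact l.Prime] {F : Type*} [Field F] [CharP F l] {I : F}

lemma intCast_eq_zero_iff_dvd (l : ℕ) {F : Type*} [Field F] [CharP F l] (a : ℤ) :
    (a : F) = 0 ↔ (l : ℤ) ∣ a := CharP.intCast_eq_zero_iff F l a

lemma two_ne_zero_of_charP_odd (hl : l % 2 = 1) : (2 : F) ≠ 0 := by
  have : ((2 : ℕ) : F) ≠ 0 := by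
    rw [Ne, CharP.cast_eq_zero_iff F l]
    intro h
    have := (Nat.prime_dvd_prime_iff_eq Fact.out Nat.prime_two).1 h
    omega
  exact_mod_cast this

/-- The Cayley transform `(α + c x i) / (α - c x i)` in characteristic `l ≡ c (mod 4)`. -/
noncomputable def cayley (l : ℕ) {F : Type*} [Field F] (I : F) (α : ℤ) (x : ℤ) : F :=
  ((α : F) + sgn4 l * x * I) / (α - sgn4 l * x * I)

lemma sgn4_sq (l : ℕ) : sgn4 l * sgn4 l = 1 := by
  unfold sgn4; split_ifs <;> rfl

lemma sgn4_cast_sq (l : ℕ) {F : Type*} [Field F] : (sgn4 l : F) * sgn4 l = 1 := by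
  exact_mod_cast congrArg (Int.cast : ℤ → F) (sgn4_sq l)

lemma cayley_factors {l : ℕ} {F : Type*} [Field F] {I : F} (hI : I * I = -1) (α x : ℤ) :
    ((α : F) + sgn4 l * x * I) * (α - sgn4 l * x * I) = ((α ^ 2 + x ^ 2 : ℤ) : F) := by
  push_cast
  linear_combination -(x : F) ^ 2 * I ^ 2 * sgn4_cast_sq l (F := F) - (x : F) ^ 2 * hI

lemma cayley_factors_ne_zero {l : ℕ} {F : Type*} [Field F] [CharP F l] {I : F}
    (hI : I * I = -1) {α x : ℤ} (hx : ¬ (l : ℤ) ∣ α ^ 2 + x ^ 2) :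
    (α : F) + sgn4 l * x * I ≠ 0 ∧ (α : F) - sgn4 l * x * I ≠ 0 := by
  have h : ((α ^ 2 + x ^ 2 : ℤ) : F) ≠ 0 := by rwa [Ne, intCast_eq_zero_iff_dvd l]
  rw [← cayley_factors (l := l) hI] at h
  exact mul_ne_zero_iff.1 h

/-- For odd `l = 4 m + c` the Cayley transform takes values in the group of `4 m`-th roots of
unity. -/
lemma cayley_pow (hl : l % 2 = 1) (hI : I * I = -1) {α x : ℤ} (hx : ¬ (l : ℤ) ∣ α ^ 2 + x ^ 2) :
    cayley l I α x ^ (4 * ((l + 1) / 4)) = 1 := by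
  obtain ⟨hu, hv⟩ := cayley_factors_ne_zero (F := F) hI hx
  have e1 := add_mul_sqrt_pow (F := F) hl hI α (sgn4 l * x)
  have e2 := add_mul_sqrt_pow (F := F) hl hI α (-(sgn4 l * x))
  have hc := sgn4_cast_sq l (F := F)
  push_cast at e1 e2
  have e2' : ((α : F) - sgn4 l * x * I) ^ l = (α : F) - (sgn4 l * sgn4 l) * x * I := by
    rw [show (α : F) - sgn4 l * x * I = α + -(sgn4 l * x) * I by ring, e2]; ring
  have e1' : ((α : F) + sgn4 l * x * I) ^ l = (α : F) + (sgn4 l * sgn4 l) * x * I := by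
    rw [e1]; ring
  rw [hc, one_mul] at e1' e2'
  rw [cayley, div_pow, div_eq_one_iff_eq (pow_ne_zero _ hv)]
  rcases sgn4_cases hl with ⟨hc, -, hm⟩ | ⟨hc, -, hm⟩
  · apply mul_right_cancel₀ (mul_ne_zero hu hv)
    calc _ = (((α : F) + sgn4 l * x * I) ^ (4 * ((l + 1) / 4) + 1)) * (α - sgn4 l * x * I) := by
          ring
      _ = (((α : F) - sgn4 l * x * I) ^ (4 * ((l + 1) / 4) + 1)) * (α + sgn4 l * x * I) := by
          rw [hm, e1', e2', hc]; push_cast; ring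
      _ = _ := by ring
  · rw [hm, pow_succ, pow_succ, e1', e2', hc]; push_cast; ring

lemma cayley_ne_neg_one (hl : l % 2 = 1) (hI : I * I = -1) {α x : ℤ} (hα : ¬ (l : ℤ) ∣ α)
    (hx : ¬ (l : ℤ) ∣ α ^ 2 + x ^ 2) : cayley l I α x ≠ -1 := by
  obtain ⟨hu, hv⟩ := cayley_factors_ne_zero (F := F) hI hx
  intro h
  rw [cayley, div_eq_iff hv] at h
  have : (2 : F) * α = 0 := by linear_combination h
  rcases mul_eq_zero.1 this with h | h
  · exact two_ne_zero_of_charP_odd hl h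
  · exact hα ((intCast_eq_zero_iff_dvd l α).1 h)

lemma cayley_inj (hl : l % 2 = 1) (hI : I * I = -1) {α x x' : ℤ} (hα : ¬ (l : ℤ) ∣ α)
    (hx : ¬ (l : ℤ) ∣ α ^ 2 + x ^ 2) (hx' : ¬ (l : ℤ) ∣ α ^ 2 + x' ^ 2)
    (h : cayley l I α x = cayley l I α x') : (l : ℤ) ∣ x - x' := by
  obtain ⟨hu, hv⟩ := cayley_factors_ne_zero (F := F) hI hx
  obtain ⟨hu', hv'⟩ := cayley_factors_ne_zero (F := F) hI hx'
  rw [cayley, cayley, div_eq_div_iff hv hv'] at h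
  have hI0 : I ≠ 0 := by rintro rfl; simp at hI
  have h2 := two_ne_zero_of_charP_odd (F := F) hl
  have hα0 : (α : F) ≠ 0 := by rwa [Ne, intCast_eq_zero_iff_dvd l]
  have hc0 : (sgn4 l : F) ≠ 0 := left_ne_zero_of_mul_eq_one (sgn4_cast_sq l)
  rw [← intCast_eq_zero_iff_dvd l (F := F)]
  have : (2 * α * sgn4 l * I) * ((x - x' : ℤ) : F) = 0 := by push_cast; linear_combination h
  exact (mul_eq_zero.1 this).resolve_left (by simp [h2, hα0, hc0, hI0])

lemma cayley_surj (hl : l % 2 = 1) (hI : I * I = -1) {α : ℤ} (hα : ¬ (l : ℤ) ∣ α) {ζ : F}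
    (hζ : ζ ^ (4 * ((l + 1) / 4)) = 1) (hζ1 : ζ ≠ -1) :
    ∃ x : ℤ, ¬ (l : ℤ) ∣ α ^ 2 + x ^ 2 ∧ cayley l I α x = ζ := by
  have hI0 : I ≠ 0 := by rintro rfl; simp at hI
  have h2 := two_ne_zero_of_charP_odd (F := F) hl
  have hα0 : (α : F) ≠ 0 := by rwa [Ne, intCast_eq_zero_iff_dvd l]
  have hc0 : (sgn4 l : F) ≠ 0 := left_ne_zero_of_mul_eq_one (sgn4_cast_sq l)
  have hlpos : 0 < (l + 1) / 4 := by
    have := (Fact.out : l.Prime).two_le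
    omega
  have hζ0 : ζ ≠ 0 := by
    rintro rfl
    rw [zero_pow (by omega)] at hζ
    exact zero_ne_one hζ
  have hζ2 : ζ + 1 ≠ 0 := fun h => hζ1 (eq_neg_of_add_eq_zero_left h)
  set X : F := α * (ζ - 1) / (sgn4 l * I * (ζ + 1)) with hX
  have hXl : X ^ l = X := by
    have e : X ^ l = frobenius F l X := rfl
    rw [e, hX, map_div₀, map_mul, map_mul, map_mul, map_sub, map_add, map_one, map_intCast,
      map_intCast, frobenius_def, frobenius_def, sqrt_neg_one_pow hl hI]
    rcases sgn4_cases hl with ⟨hc, -, hm⟩ | ⟨hc, -, hm⟩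
    · have : ζ ^ l = ζ := by rw [← hm, pow_succ, hζ, one_mul]
      rw [this, hc]; simp
    · have h1 : ζ ^ l * ζ = 1 := by rw [← pow_succ, ← hm, hζ]
      have h3 : ζ ^ l = ζ⁻¹ := eq_inv_of_mul_eq_one_left h1
      have h4 : ζ⁻¹ + 1 ≠ 0 := by
        intro h
        apply hζ2
        have := congrArg (· * ζ) h
        simp only [add_mul, inv_mul_cancel₀ hζ0, one_mul, zero_mul] at this
        linear_combination this
      rw [h3, hc]
      push_cast
      rw [div_eq_div_iff (by simp [hI0, h4]) (by simp [hI0, hζ2])]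
      field_simp
      ring
  obtain ⟨x, hx⟩ := (mem_bot_iff_intCast l F).1 ((Subfield.mem_bot_iff_pow_eq_self F l).2 hXl)
  have hkey : (sgn4 l : F) * x * I * (ζ + 1) = α * (ζ - 1) := by
    rw [hx, hX]
    field_simp
  have hu : ((α : F) + sgn4 l * x * I) * (ζ + 1) = 2 * α * ζ := by linear_combination hkey
  have hv : ((α : F) - sgn4 l * x * I) * (ζ + 1) = 2 * α := by linear_combination -hkey
  have hu0 : (α : F) + sgn4 l * x * I ≠ 0 := by
    intro h
    rw [h, zero_mul] at hu
    exact mul_ne_zero (mul_ne_zero h2 hα0) hζ0 hu.symm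
  have hv0 : (α : F) - sgn4 l * x * I ≠ 0 := by
    intro h
    rw [h, zero_mul] at hv
    exact mul_ne_zero h2 hα0 hv.symm
  refine ⟨x, ?_, ?_⟩
  · rw [← intCast_eq_zero_iff_dvd l (F := F), ← cayley_factors (l := l) hI]
    exact mul_ne_zero hu0 hv0
  · rw [cayley, div_eq_iff hv0]
    apply mul_right_cancel₀ hζ2
    linear_combination hu - ζ * hv

lemma exists_primitive_root [IsAlgClosed F] (hl : l % 2 = 1) :
    ∃ ζ : F, IsPrimitiveRoot ζ (4 * ((l + 1) / 4)) := by
  have hlpr : l.Prime := Fact.out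
  have : NeZero ((4 * ((l + 1) / 4) : ℕ) : F) := by
    constructor
    rw [Ne, CharP.cast_eq_zero_iff F l]
    intro h
    have h1 := Nat.le_of_dvd (by have := hlpr.two_le; omega) h
    rcases sgn4_cases hl with ⟨hc, -, hm⟩ | ⟨hc, -, hm⟩
    · omega
    · rw [hm] at h
      have := (Nat.dvd_add_right (dvd_refl l)).1 h
      exact hlpr.one_lt.ne' (Nat.dvd_one.1 this)
  exact HasEnoughRootsOfUnity.exists_primitiveRoot F _

/-- The power sums of the quartic character `ζ ↦ ζ ^ m` on the group of `4 m`-th roots of unity. -/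
lemma sum_quartLift_pow {m : ℕ} (hm : 0 < m) (hI : I * I = -1) (h2 : (2 : F) ≠ 0) {ζ : F}
    (hζ : IsPrimitiveRoot ζ (4 * m)) (e : ℕ) :
    ∑ z ∈ Polynomial.nthRootsFinset (4 * m) (1 : F), quartLift I (z ^ m) ^ e
      = if 4 ∣ e then (4 * m : GaussianInt) else 0 := by
  have hz4 : ∀ z ∈ Polynomial.nthRootsFinset (4 * m) (1 : F), (z ^ m) ^ 4 = 1 := fun z hz => by
    rw [← pow_mul, mul_comm]
    exact (Polynomial.mem_nthRootsFinset (by omega) 1).1 hz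
  split_ifs with he
  · obtain ⟨k, rfl⟩ := he
    rw [Finset.sum_congr rfl (g := fun _ => 1) fun z hz => by
      rw [pow_mul, (isGaussUnit_quartLift hI h2 (hz4 z hz)).pow_four, one_pow],
      Finset.sum_const, hζ.card_nthRootsFinset]
    simp
  · have hζ4 : (ζ ^ m) ^ 4 = 1 := by rw [← pow_mul, mul_comm, hζ.pow_eq_one]
    set S := ∑ z ∈ Polynomial.nthRootsFinset (4 * m) (1 : F), quartLift I (z ^ m) ^ e with hS
    have hmul : S = quartLift I (ζ ^ m) ^ e * S := by
      conv_lhs => rw [hS]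
      rw [hS, Finset.mul_sum]
      have hζ0 : ζ ≠ 0 := hζ.ne_zero (by omega)
      refine (Finset.sum_bij (fun z _ => ζ * z) ?_ ?_ ?_ ?_).symm
      · intro z hz
        rw [Polynomial.mem_nthRootsFinset (by omega)] at hz ⊢
        rw [mul_pow, hz, hζ.pow_eq_one, one_mul]
      · intro z _ z' _ h
        exact mul_left_cancel₀ hζ0 h
      · intro z hz
        refine ⟨ζ⁻¹ * z, ?_, by rw [← mul_assoc, mul_inv_cancel₀ hζ0, one_mul]⟩
        rw [Polynomial.mem_nthRootsFinset (by omega)] at hz ⊢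
        rw [mul_pow, hz, inv_pow, hζ.pow_eq_one, inv_one, one_mul]
      · intro z hz
        rw [mul_pow, quartLift_mul hI h2 hζ4 (hz4 z hz), mul_pow]
    have hne : quartLift I (ζ ^ m) ^ e ≠ 1 := by
      intro h
      have := congrArg (gaussEval I hI) h
      rw [map_pow, map_one, gaussEval_quartLift hI h2 hζ4, ← pow_mul, hζ.pow_eq_one_iff_dvd] at this
      rw [mul_comm 4 m] at this
      exact he (Nat.dvd_of_mul_dvd_mul_left hm this)
    have : (1 - quartLift I (ζ ^ m) ^ e) * S = 0 := by linear_combination hmul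
    exact (mul_eq_zero.1 this).resolve_left (sub_ne_zero.2 hne.symm)

lemma quartLift_neg_one_pow (hI : I * I = -1) (h2 : (2 : F) ≠ 0) (m : ℕ) :
    quartLift I ((-1 : F) ^ m) = (-1) ^ m := by
  rw [quartLift_pow hI h2 (by norm_num), quartLift_neg_one hI h2]

/-- The power sums of the local quartic symbol at a prime `l ∤ α`: the Cayley transform is a
bijection onto the `4 m`-th roots of unity different from `-1`. -/
lemma sum_local_of_not_dvd [IsAlgClosed F] (hl : l % 2 = 1) (hI : I * I = -1) {α : ℤ}
    (hα : ¬ (l : ℤ) ∣ α) (e : ℕ) :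
    ∑ x ∈ (Finset.range l).filter (fun x : ℕ => ¬ (l : ℤ) ∣ α ^ 2 + (x : ℤ) ^ 2),
        quartLift I (cayley l I α x ^ ((l + 1) / 4)) ^ e
      = (if 4 ∣ e then (4 * ((l + 1) / 4 : ℕ) : GaussianInt) else 0)
        - (-1) ^ ((l + 1) / 4 * e) := by
  have h2 := two_ne_zero_of_charP_odd (F := F) hl
  have hlpr : l.Prime := Fact.out
  have hmpos : 0 < (l + 1) / 4 := by have := hlpr.two_le; omega
  obtain ⟨ζ, hζ⟩ := exists_primitive_root (F := F) hl
  rw [← sum_quartLift_pow hmpos hI h2 hζ e]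
  have hmem : (-1 : F) ∈ Polynomial.nthRootsFinset (4 * ((l + 1) / 4)) (1 : F) := by
    rw [Polynomial.mem_nthRootsFinset (by omega), pow_mul]
    norm_num
  classical
  rw [← Finset.sum_erase_add _ _ hmem, quartLift_neg_one_pow hI h2, ← pow_mul, add_sub_cancel_right]
  -- the summand at the missing root `ζ = -1` is the correction term
  refine Finset.sum_bij (fun x _ => cayley l I α x) ?_ ?_ ?_ ?_
  · intro x hx
    rw [Finset.mem_filter] at hx
    rw [Finset.mem_erase, Polynomial.mem_nthRootsFinset (by omega)]
    exact ⟨cayley_ne_neg_one hl hI hα hx.2, cayley_pow hl hI hx.2⟩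
  · intro x hx x' hx' h
    rw [Finset.mem_filter, Finset.mem_range] at hx hx'
    have h1 := cayley_inj hl hI hα hx.2 hx'.2 h
    have h4 : (x : ℤ) % l = x' % l := (Int.emod_eq_emod_iff_emod_sub_eq_zero).2
      (Int.emod_eq_zero_of_dvd h1)
    rw [Int.emod_eq_of_lt (by positivity) (by exact_mod_cast hx.1),
      Int.emod_eq_of_lt (by positivity) (by exact_mod_cast hx'.1)] at h4
    exact_mod_cast h4
  · intro z hz
    rw [Finset.mem_erase, Polynomial.mem_nthRootsFinset (by omega)] at hz
    obtain ⟨x, hx, hxz⟩ := cayley_surj hl hI hα hz.2 hz.1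
    have hl0 : (l : ℤ) ≠ 0 := by exact_mod_cast hlpr.ne_zero
    have hcast : (((x % l).toNat : ℕ) : ℤ) = x % l := Int.toNat_of_nonneg (Int.emod_nonneg _ hl0)
    refine ⟨(x % l).toNat, ?_, ?_⟩
    · rw [Finset.mem_filter, Finset.mem_range, hcast]
      refine ⟨?_, ?_⟩
      · have := Int.emod_lt_of_pos x (show (0 : ℤ) < l by exact_mod_cast hlpr.pos)
        omega
      · intro h
        apply hx
        rw [show α ^ 2 + x ^ 2 = α ^ 2 + (x % l) ^ 2 + (x ^ 2 - (x % l) ^ 2) by ring]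
        refine dvd_add h ?_
        have h1 : (l : ℤ) ∣ x ^ 2 - (x % l) ^ 2 := by
          refine dvd_trans ?_ (sub_dvd_pow_sub_pow x (x % l) 2)
          exact Int.dvd_self_sub_emod
        exact h1
    · rw [← hxz, hcast]
      have : ((x % l : ℤ) : F) = x := by
        rw [← sub_eq_zero, ← Int.cast_sub, intCast_eq_zero_iff_dvd l]
        exact (dvd_sub_comm).1 (Int.dvd_self_sub_emod)
      rw [cayley, cayley, this]
  · intro x _
    rfl

/-- The power sums of the local quartic symbol at a prime `l ∣ α`, where it is constant. -/
lemma sum_local_of_dvd (hl : l % 2 = 1) (hI : I * I = -1) {α : ℤ} (hα : (l : ℤ) ∣ α) (e : ℕ) :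
    ∑ x ∈ (Finset.range l).filter (fun x : ℕ => ¬ (l : ℤ) ∣ α ^ 2 + (x : ℤ) ^ 2),
        quartLift I (cayley l I α x ^ ((l + 1) / 4)) ^ e
      = ((l : GaussianInt) - 1) * (-1) ^ ((l + 1) / 4 * e) := by
  have h2 := two_ne_zero_of_charP_odd (F := F) hl
  have hlpr : l.Prime := Fact.out
  have hα0 : (α : F) = 0 := (intCast_eq_zero_iff_dvd l α).2 hα
  have hiff : ∀ x : ℕ, (l : ℤ) ∣ α ^ 2 + (x : ℤ) ^ 2 ↔ l ∣ x := fun x => by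
    rw [Int.dvd_add_right (dvd_pow hα two_ne_zero)]
    rw [(Nat.prime_iff_prime_int.1 hlpr).dvd_pow_iff_dvd two_ne_zero]
    exact Int.natCast_dvd_natCast
  have hset : (Finset.range l).filter (fun x : ℕ => ¬ (l : ℤ) ∣ α ^ 2 + (x : ℤ) ^ 2)
      = (Finset.range l).erase 0 := by
    ext x
    rw [Finset.mem_filter, Finset.mem_erase, Finset.mem_range, hiff, and_comm]
    refine and_congr_left fun hx => not_congr ⟨fun h => Nat.eq_zero_of_dvd_of_lt h hx, ?_⟩
    rintro rfl
    exact dvd_zero l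
  have hval : ∀ x ∈ (Finset.range l).filter (fun x : ℕ => ¬ (l : ℤ) ∣ α ^ 2 + (x : ℤ) ^ 2),
      quartLift I (cayley l I α x ^ ((l + 1) / 4)) ^ e = (-1) ^ ((l + 1) / 4 * e) := fun x hx => by
    have h := (cayley_factors_ne_zero (F := F) hI (Finset.mem_filter.1 hx).2).2
    have : cayley l I α x = -1 := by
      rw [cayley, div_eq_iff h, hα0]; ring
    rw [this, quartLift_neg_one_pow hI h2, ← pow_mul]
  rw [Finset.sum_congr rfl hval, Finset.sum_const, hset, Finset.card_erase_of_mem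
    (Finset.mem_range.2 hlpr.pos), Finset.card_range, nsmul_eq_mul]
  push_cast [hlpr.one_le]
  ring

end

/-! ### Local symbols and the count of residues with a given global symbol -/

/-- A square root of `-1` in an algebraic closure of `𝔽_l`. -/
noncomputable def rootI (l : ℕ) [Fact l.Prime] : AlgebraicClosure (ZMod l) :=
  (IsAlgClosed.exists_pow_nat_eq (-1 : AlgebraicClosure (ZMod l)) two_pos).choose

lemma rootI_mul_self (l : ℕ) [Fact l.Prime] : rootI l * rootI l = -1 := by
  rw [← pow_two]
  exact (IsAlgClosed.exists_pow_nat_eq (-1 : AlgebraicClosure (ZMod l)) two_pos).choose_spec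

open Classical in
/-- The local quartic symbol at an odd prime `l = 4 m + c`: the fourth root of unity in `ℤ[i]` that
reduces to `((α + c x i) / (α - c x i)) ^ m` in characteristic `l`. For `p = α² + x²` it is the
quartic residue symbol of `c l` modulo `α + x i`. -/
noncomputable def locSymbol (l : ℕ) (α : ℤ) (x : ℕ) : GaussianInt :=
  if h : l.Prime then
    have := Fact.mk h
    quartLift (rootI l) (cayley l (rootI l) α x ^ ((l + 1) / 4))
  else 0

lemma locSymbol_eq (l : ℕ) [h : Fact l.Prime] (α : ℤ) (x : ℕ) :
    locSymbol l α x = quartLift (rootI l) (cayley l (rootI l) α x ^ ((l + 1) / 4)) := by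
  rw [locSymbol, dif_pos h.out]

lemma locSymbol_mod (l : ℕ) (α : ℤ) (x : ℕ) : locSymbol l α (x % l) = locSymbol l α x := by
  by_cases h : l.Prime
  · have := Fact.mk h
    rw [locSymbol_eq, locSymbol_eq, cayley, cayley]
    have : (((x % l : ℕ) : ℤ) : AlgebraicClosure (ZMod l)) =
        ((x : ℤ) : AlgebraicClosure (ZMod l)) := by
      rw [Int.cast_natCast, Int.cast_natCast]
      exact (CharP.cast_eq_mod (AlgebraicClosure (ZMod l)) l x).symm
    rw [this]
  · simp [locSymbol, h]

lemma isGaussUnit_locSymbol {l : ℕ} (hlp : l.Prime) (hl : l % 2 = 1) {α : ℤ} {x : ℕ}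
    (hx : ¬ (l : ℤ) ∣ α ^ 2 + (x : ℤ) ^ 2) : IsGaussUnit (locSymbol l α x) := by
  have := Fact.mk hlp
  rw [locSymbol_eq]
  refine isGaussUnit_quartLift (rootI_mul_self l) (two_ne_zero_of_charP_odd hl) ?_
  rw [← pow_mul, mul_comm]
  exact cayley_pow hl (rootI_mul_self l) hx

/-- The number of residues `x` modulo `l` with `l ∤ α² + x²`, in closed form. -/
def locCount (α : ℤ) (l : ℕ) : ℤ := if (l : ℤ) ∣ α then l - 1 else 4 * ((l + 1) / 4 : ℕ) - 1

/-- The sum of the `e`-th powers of the local symbol over the residues `x` modulo `l`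
with `l ∤ α² + x²`, in closed form: see `sum_locSymbol_pow`. -/
def locSum (α : ℤ) (l e : ℕ) : ℤ :=
  if (l : ℤ) ∣ α then (l - 1) * (-1) ^ ((l + 1) / 4 * e)
  else (if 4 ∣ e then 4 * ((l + 1) / 4 : ℕ) else 0) - (-1) ^ ((l + 1) / 4 * e)

lemma locSum_zero (α : ℤ) (l : ℕ) : locSum α l 0 = locCount α l := by
  simp [locSum, locCount]

lemma locCount_pos {l : ℕ} (hl : l % 2 = 1) (hl1 : 1 < l) (α : ℤ) : 0 < locCount α l := by
  unfold locCount
  split_ifs <;> omega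

lemma sum_locSymbol_pow {l : ℕ} (hlp : l.Prime) (hl : l % 2 = 1) (α : ℤ) (e : ℕ) :
    ∑ x ∈ Finset.range l, (if (l : ℤ) ∣ α ^ 2 + (x : ℤ) ^ 2 then 0 else locSymbol l α x ^ e)
      = (locSum α l e : GaussianInt) := by
  have := Fact.mk hlp
  have h0 : ∑ x ∈ Finset.range l,
        (if (l : ℤ) ∣ α ^ 2 + (x : ℤ) ^ 2 then 0 else locSymbol l α x ^ e)
      = ∑ x ∈ (Finset.range l).filter (fun x : ℕ => ¬ (l : ℤ) ∣ α ^ 2 + (x : ℤ) ^ 2),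
        locSymbol l α x ^ e := by
    rw [Finset.sum_filter]
    refine Finset.sum_congr rfl fun x _ => ?_
    by_cases h : (l : ℤ) ∣ α ^ 2 + (x : ℤ) ^ 2 <;> simp [h]
  rw [h0]
  simp_rw [locSymbol_eq]
  unfold locSum
  split_ifs with h1 h2
  · rw [sum_local_of_dvd hl (rootI_mul_self l) h1]; generalize (l + 1) / 4 = m; push_cast; ring
  · rw [sum_local_of_not_dvd hl (rootI_mul_self l) h1, if_pos h2]
    generalize (l + 1) / 4 = m
    push_cast
    ring
  · rw [sum_local_of_not_dvd hl (rootI_mul_self l) h1, if_neg h2]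
    generalize (l + 1) / 4 = m
    push_cast
    ring

/-- For `p = α² + x²` the quartic residue symbol of `c l` is the local symbol at `l`. -/
lemma quartChar_eq_locSymbol {p : ℕ} [Fact p.Prime] (hp : p % 4 = 1) {f : ZMod p}
    (hf : f * f = -1) {l : ℕ} (hlpr : l.Prime) (hl : l % 2 = 1) (hlp : l ≠ p) {α : ℤ} {y : ℕ}
    (hα : α % 4 = 1) (hpx : (p : ℤ) = α ^ 2 + (2 * (y : ℤ)) ^ 2)
    (hfx : (α : ZMod p) + (2 * (y : ℤ) : ℤ) * f = 0) :
    quartChar p hp f hf ((sgn4 l * l : ℤ) : ZMod p) = locSymbol l α (2 * y) := by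
  have := Fact.mk hlpr
  have hp0 : NeZero ((p : ℕ) : AlgebraicClosure (ZMod l)) := by
    constructor
    rw [Ne, CharP.cast_eq_zero_iff _ l]
    intro h
    exact hlp ((Nat.prime_dvd_prime_iff_eq hlpr Fact.out).1 h)
  obtain ⟨ζ, hζ⟩ := HasEnoughRootsOfUnity.exists_primitiveRoot (AlgebraicClosure (ZMod l)) p
  have key := gaussEval_quartChar_prime hp hf hl (rootI_mul_self l) hlp
    (AddChar.zmodChar_primitive_of_primitive_root p hζ) hα hpx hfx
  have hne : ((sgn4 l * l : ℤ) : ZMod p) ≠ 0 := by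
    intro h
    have h1 : ((sgn4 l * (sgn4 l * l) : ℤ) : ZMod p) = 0 := by
      rw [Int.cast_mul, h, mul_zero]
    rw [← mul_assoc, sgn4_sq, one_mul, Int.cast_natCast, ZMod.natCast_eq_zero_iff] at h1
    exact hlp ((Nat.prime_dvd_prime_iff_eq Fact.out hlpr).1 h1).symm
  rw [quartLift_eq_of_gaussEval_eq (rootI_mul_self l) (two_ne_zero_of_charP_odd hl)
    (isGaussUnit_quartChar hp hf hne) key, locSymbol_eq, cayley]
  push_cast
  rfl

/-- The Chinese remainder theorem for sums of products of periodic functions. -/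
lemma sum_range_mul_of_periodic {R : Type*} [CommRing R] {a b : ℕ} (ha : 0 < a) (hb : 0 < b)
    (hab : a.Coprime b) (g h : ℕ → R) (hg : ∀ x, g (x % a) = g x) (hh : ∀ x, h (x % b) = h x) :
    ∑ x ∈ Finset.range (a * b), g x * h x
      = (∑ x ∈ Finset.range a, g x) * ∑ x ∈ Finset.range b, h x := by
  rw [Finset.sum_mul_sum, ← Finset.sum_product']
  refine Finset.sum_bij (fun x _ => (x % a, x % b)) ?_ ?_ ?_ ?_
  · intro x _
    simp [Nat.mod_lt _ ha, Nat.mod_lt _ hb]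
  · intro x hx x' hx' hxx
    simp only [Prod.mk.injEq] at hxx
    have : x ≡ x' [MOD a * b] := (Nat.modEq_and_modEq_iff_modEq_mul hab).1 ⟨hxx.1, hxx.2⟩
    rw [Finset.mem_range] at hx hx'
    rwa [Nat.ModEq, Nat.mod_eq_of_lt hx, Nat.mod_eq_of_lt hx'] at this
  · rintro ⟨u, v⟩ huv
    rw [Finset.mem_product, Finset.mem_range, Finset.mem_range] at huv
    obtain ⟨k, hk1, hk2⟩ := Nat.chineseRemainder hab u v
    refine ⟨k % (a * b), Finset.mem_range.2 (Nat.mod_lt _ (Nat.mul_pos ha hb)), ?_⟩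
    simp only [Nat.mod_mul_right_mod, Nat.mod_mul_left_mod]
    rw [hk1, hk2, Nat.mod_eq_of_lt huv.1, Nat.mod_eq_of_lt huv.2]
  · intro x _
    simp only [hg, hh]

lemma sum_range_prod_of_periodic {R : Type*} [CommRing R] (L : Finset ℕ) {M₀ : ℕ} (hM₀ : 0 < M₀)
    (hpos : ∀ l ∈ L, 0 < l) (hM : ∀ l ∈ L, M₀.Coprime l)
    (hL : ∀ l ∈ L, ∀ l' ∈ L, l ≠ l' → l.Coprime l') (θ : ℕ → R) (hθ : ∀ x, θ (x % M₀) = θ x)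
    (g : ℕ → ℕ → R) (hg : ∀ l ∈ L, ∀ x, g l (x % l) = g l x) :
    ∑ x ∈ Finset.range (M₀ * ∏ l ∈ L, l), θ x * ∏ l ∈ L, g l x
      = (∑ x ∈ Finset.range M₀, θ x) * ∏ l ∈ L, ∑ x ∈ Finset.range l, g l x := by
  rw [sum_range_mul_of_periodic hM₀ (Finset.prod_pos hpos) (Nat.Coprime.prod_right hM) θ
    (fun x => ∏ l ∈ L, g l x) hθ]
  · congr 1
    clear hM
    induction L using Finset.induction_on with
    | empty => simp
    | insert l L hl ih =>
      have hdvd : ∀ l' ∈ L, l' ∣ ∏ l ∈ L, l := fun l' h => Finset.dvd_prod_of_mem _ h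
      simp_rw [Finset.prod_insert hl]
      rw [sum_range_mul_of_periodic (hpos l (Finset.mem_insert_self ..))
        (Finset.prod_pos fun l' h => hpos l' (Finset.mem_insert_of_mem h))
        (Nat.Coprime.prod_right fun l' h => hL l (Finset.mem_insert_self ..) l'
          (Finset.mem_insert_of_mem h) (fun h' => hl (h' ▸ h)))
        (g l) (fun x => ∏ l ∈ L, g l x) (hg l (Finset.mem_insert_self ..)), ih]
      · exact fun l' h => hpos l' (Finset.mem_insert_of_mem h)
      · exact fun l' h l'' h' =>
          hL l' (Finset.mem_insert_of_mem h) l'' (Finset.mem_insert_of_mem h')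
      · exact fun l' h => hg l' (Finset.mem_insert_of_mem h)
      · intro x
        refine Finset.prod_congr rfl fun l' h => ?_
        rw [← hg l' (Finset.mem_insert_of_mem h), Nat.mod_mod_of_dvd _ (hdvd l' h),
          hg l' (Finset.mem_insert_of_mem h)]
  · intro x
    refine Finset.prod_congr rfl fun l h => ?_
    rw [← hg l h, Nat.mod_mod_of_dvd _ (Finset.dvd_prod_of_mem _ h), hg l h]

lemma giPow_sum (j : ℕ) :
    ∑ x ∈ Finset.range 8, (if 2 ∣ x then giPow ((x / 2 : ℕ) : ℤ) ^ j else 0)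
      = if 4 ∣ j then 4 else 0 := by
  have h0 : giPow 0 = 1 := rfl
  have h1 : giPow 1 = gi := rfl
  have h2 : giPow 2 = -1 := rfl
  have h3 : giPow 3 = -gi := rfl
  have hj : gi ^ j = gi ^ (j % 4) := gi_pow_mod j
  have e1 : (-1 : GaussianInt) ^ j = gi ^ (2 * (j % 4)) := by
    rw [← gi_sq, ← pow_mul, gi_pow_mod, gi_pow_mod (2 * (j % 4))]
    congr 1; omega
  have e2 : (-gi : GaussianInt) ^ j = gi ^ (3 * (j % 4)) := by
    rw [show -gi = gi ^ 3 from rfl, ← pow_mul, gi_pow_mod, gi_pow_mod (3 * (j % 4))]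
    congr 1; omega
  simp only [Finset.sum_range_succ, Finset.sum_range_zero]
  norm_num [h0, h1, h2, h3]
  rw [hj, e1, e2]
  have : j % 4 = 0 ∨ j % 4 = 1 ∨ j % 4 = 2 ∨ j % 4 = 3 := by omega
  rcases this with h | h | h | h <;> rw [h]
  · rw [if_pos (by omega)]; rfl
  · rw [if_neg (by omega)]; rfl
  · rw [if_neg (by omega)]; rfl
  · rw [if_neg (by omega)]; rfl

/-- The residues `x` modulo `8 ∏ l` for which `α² + x²` is prime to the modulus. -/
def admissible (α : ℤ) (L : Finset ℕ) : Finset ℕ :=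
  (Finset.range (8 * ∏ l ∈ L, l)).filter
    (fun x => 2 ∣ x ∧ ∀ l ∈ L, ¬ (l : ℤ) ∣ α ^ 2 + (x : ℤ) ^ 2)

/-- The value `(-1) ^ (x / 2) χ(-D)` as a function of `x`: here `K` collects the contributions of
`-1` and `2`, and `e l` is the exponent of `l` in `D`. -/
noncomputable def globSymbol (α : ℤ) (L : Finset ℕ) (K : ℕ) (e : ℕ → ℕ) (x : ℕ) : GaussianInt :=
  giPow ((x / 2 : ℕ) : ℤ) ^ K * ∏ l ∈ L, locSymbol l α x ^ e l

lemma sum_globSymbol {α : ℤ} {L : Finset ℕ} (hL : ∀ l ∈ L, l.Prime ∧ l % 2 = 1) (K : ℕ)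
    (e : ℕ → ℕ) :
    ∑ x ∈ admissible α L, globSymbol α L K e x
      = (((if 4 ∣ K then 4 else 0) * ∏ l ∈ L, locSum α l (e l) : ℤ) : GaussianInt) := by
  have h1 : ∑ x ∈ admissible α L, globSymbol α L K e x
      = ∑ x ∈ Finset.range (8 * ∏ l ∈ L, l),
        (if 2 ∣ x then giPow ((x / 2 : ℕ) : ℤ) ^ K else 0) *
        ∏ l ∈ L, (if (l : ℤ) ∣ α ^ 2 + (x : ℤ) ^ 2 then 0 else locSymbol l α x ^ e l) := by
    rw [admissible, Finset.sum_filter]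
    refine Finset.sum_congr rfl fun x _ => ?_
    split_ifs with h h'
    · rw [globSymbol]
      congr 1
      exact Finset.prod_congr rfl fun l hl => (if_neg (h.2 l hl)).symm
    · exact absurd h.1 h'
    · simp only [not_and, not_forall, not_not] at h
      obtain ⟨l, hl, hd⟩ := h ‹_›
      rw [Finset.prod_eq_zero
        (f := fun l : ℕ => if (l : ℤ) ∣ α ^ 2 + (x : ℤ) ^ 2 then 0 else locSymbol l α x ^ e l)
        hl (if_pos hd), mul_zero]
    · rw [zero_mul]
  have hcop : ∀ l ∈ L, Nat.Coprime 8 l := fun l hl => by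
    have : Nat.Coprime 2 l := Nat.coprime_two_left.2 (Nat.odd_iff.2 (hL l hl).2)
    exact Nat.Coprime.pow_left 3 this
  have hper2 : ∀ x : ℕ, (if 2 ∣ x % 8 then giPow ((x % 8 / 2 : ℕ) : ℤ) ^ K else 0)
      = if 2 ∣ x then giPow ((x / 2 : ℕ) : ℤ) ^ K else 0 := fun x => by
    have h2 : 2 ∣ x % 8 ↔ 2 ∣ x := by omega
    simp only [h2]
    split_ifs with h
    · congr 1
      rw [giPow, giPow]
      congr 2
      omega
    · rfl
  have hper : ∀ l ∈ L, ∀ x : ℕ,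
      (if (l : ℤ) ∣ α ^ 2 + ((x % l : ℕ) : ℤ) ^ 2 then 0 else locSymbol l α (x % l) ^ e l)
      = if (l : ℤ) ∣ α ^ 2 + (x : ℤ) ^ 2 then 0 else locSymbol l α x ^ e l := fun l hl x => by
    have : (l : ℤ) ∣ α ^ 2 + ((x % l : ℕ) : ℤ) ^ 2 ↔ (l : ℤ) ∣ α ^ 2 + (x : ℤ) ^ 2 := by
      rw [← ZMod.intCast_zmod_eq_zero_iff_dvd, ← ZMod.intCast_zmod_eq_zero_iff_dvd]
      push_cast
      simp
    simp only [this, locSymbol_mod]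
  rw [h1, sum_range_prod_of_periodic L (by norm_num) (fun l hl => (hL l hl).1.pos) hcop
    (fun l hl l' hl' hne => (Nat.coprime_primes (hL l hl).1 (hL l' hl').1).2 hne)
    (fun x => if 2 ∣ x then giPow ((x / 2 : ℕ) : ℤ) ^ K else 0) hper2
    (fun l x => if (l : ℤ) ∣ α ^ 2 + (x : ℤ) ^ 2 then 0 else locSymbol l α x ^ e l) hper, giPow_sum,
    Finset.prod_congr rfl fun l hl => sum_locSymbol_pow (hL l hl).1 (hL l hl).2 α (e l)]
  push_cast
  rfl

lemma isGaussUnit_pow {z : GaussianInt} (h : IsGaussUnit z) (n : ℕ) : IsGaussUnit (z ^ n) :=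
  isGaussUnit_of_pow_four (by rw [← pow_mul, mul_comm, pow_mul, h.pow_four, one_pow])

lemma isGaussUnit_globSymbol {α : ℤ} {L : Finset ℕ} (hL : ∀ l ∈ L, l.Prime ∧ l % 2 = 1) (K : ℕ)
    (e : ℕ → ℕ) {x : ℕ} (hx : x ∈ admissible α L) : IsGaussUnit (globSymbol α L K e x) := by
  refine (isGaussUnit_pow (isGaussUnit_giPow _) K).mul ?_
  refine Finset.prod_induction _ IsGaussUnit (fun _ _ => IsGaussUnit.mul) (.inl rfl) fun l hl => ?_
  exact isGaussUnit_pow (isGaussUnit_locSymbol (hL l hl).1 (hL l hl).2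
    ((Finset.mem_filter.1 hx).2.2 l hl)) _

lemma card_admissible {α : ℤ} {L : Finset ℕ} (hL : ∀ l ∈ L, l.Prime ∧ l % 2 = 1) :
    ((admissible α L).card : ℤ) = 4 * ∏ l ∈ L, locCount α l := by
  have h := sum_globSymbol (α := α) hL 0 (fun _ => 0)
  simp only [globSymbol, pow_zero, Finset.prod_const_one, mul_one, Finset.sum_const, nsmul_eq_mul,
    locSum_zero, dvd_zero, if_true] at h
  exact_mod_cast h

/-- The number of admissible residues with symbol `1` (for `s = 1`) or `-1` (for `s = -1`): the
indicator function of `q = s` among the fourth roots of unity is `(1 + q² + s (q + q̄)) / 4`. -/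
lemma card_globSymbol_eq {α : ℤ} {L : Finset ℕ} (hL : ∀ l ∈ L, l.Prime ∧ l % 2 = 1) (K : ℕ)
    (e : ℕ → ℕ) (s : ℤ) (hs : s = 1 ∨ s = -1) :
    4 * (((admissible α L).filter (fun x => globSymbol α L K e x = s)).card : ℤ)
      = 4 * ∏ l ∈ L, locCount α l
        + (if 4 ∣ 2 * K then 4 else 0) * ∏ l ∈ L, locSum α l (2 * e l)
        + 2 * s * ((if 4 ∣ K then 4 else 0) * ∏ l ∈ L, locSum α l (e l)) := by
  have h2 : ∑ x ∈ admissible α L, (globSymbol α L K e x) ^ 2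
      = (((if 4 ∣ 2 * K then 4 else 0) * ∏ l ∈ L, locSum α l (2 * e l) : ℤ) : GaussianInt) := by
    rw [← sum_globSymbol hL (2 * K) (fun l => 2 * e l)]
    refine Finset.sum_congr rfl fun x _ => ?_
    rw [globSymbol, globSymbol, mul_pow, ← pow_mul, mul_comm K 2, ← Finset.prod_pow]
    simp_rw [← pow_mul, mul_comm _ 2]
  have h1 := sum_globSymbol (α := α) hL K e
  have hre2 := congrArg Zsqrtd.re h2
  have hre1 := congrArg Zsqrtd.re h1
  rw [Zsqrtd.re_intCast] at hre1 hre2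
  have hsum : ∀ g : ℕ → GaussianInt, (∑ x ∈ admissible α L, g x).re
      = ∑ x ∈ admissible α L, (g x).re := fun g => by
    induction admissible α L using Finset.induction_on with
    | empty => rfl
    | insert a S ha ih => rw [Finset.sum_insert ha, Finset.sum_insert ha, Zsqrtd.re_add, ih]
  rw [hsum] at hre1 hre2
  rw [← hre1, ← hre2, ← card_admissible hL, Finset.card_filter, Finset.mul_sum,
    Finset.card_eq_sum_ones]
  push_cast
  rw [Finset.mul_sum, ← Finset.sum_add_distrib, ← Finset.sum_add_distrib]
  refine Finset.sum_congr rfl fun x hx => ?_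
  have n1 : (-1 : GaussianInt) ≠ 1 := by decide
  have n2 : gi ≠ 1 := by decide
  have n3 : gi ≠ -1 := by decide
  have n4 : -gi ≠ 1 := by decide
  have n5 : -gi ≠ -1 := by decide
  rcases hs with rfl | rfl <;>
    rcases isGaussUnit_globSymbol hL K e hx with h | h | h | h <;> rw [h] <;>
    simp only [Int.cast_one, Int.cast_neg, n1, n1.symm, n2, n3, n4, n5, if_true, if_false] <;> rfl

/-! ### Densities of residue classes under the Hardy-Littlewood conjecture -/

/-- The comparison function `√n / log n` of the Hardy-Littlewood conjecture. -/
noncomputable def hlScale (n : ℕ) : ℝ := Real.sqrt (n : ℝ) / Real.log (n : ℝ)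

lemma tendsto_hlScale : Tendsto hlScale atTop atTop := by
  have h1 : Tendsto (fun x : ℝ => Real.log x / x ^ (1 / 2 : ℝ)) atTop (𝓝 0) :=
    (isLittleO_log_rpow_atTop (by norm_num : (0 : ℝ) < 1 / 2)).tendsto_div_nhds_zero
  have h2 : Tendsto (fun x : ℝ => Real.log x / x ^ (1 / 2 : ℝ)) atTop (𝓝[>] 0) := by
    rw [tendsto_nhdsWithin_iff]
    refine ⟨h1, ?_⟩
    filter_upwards [eventually_gt_atTop 1] with x hx
    exact div_pos (Real.log_pos hx) (Real.rpow_pos_of_pos (by linarith) _)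
  have h3 := h2.inv_tendsto_nhdsGT_zero.comp (tendsto_natCast_atTop_atTop (R := ℝ))
  refine h3.congr fun n => ?_
  simp only [Function.comp, Pi.inv_apply, inv_div, hlScale, Real.sqrt_eq_rpow]

lemma hlScale_ne_zero : ∀ᶠ n in atTop, hlScale n ≠ 0 :=
  (tendsto_hlScale.eventually_gt_atTop 0).mono fun _ h => h.ne'

/-- The Hardy-Littlewood constant of `x² + 1` cannot vanish: otherwise no prime would be of the
form `x² + 1`, but `2 = 1² + 1`. -/
lemma exists_ne_zero_hlConstant (hHL : HardyLittlewoodConjecture) :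
    ∃ δ : ℝ, δ ≠ 0 ∧ IsHLConstant 1 0 1 δ := by
  obtain ⟨δ, h1, h2⟩ := hHL 1 0 1 one_pos (by decide) (by decide) (by
    rintro ⟨r, hr⟩
    nlinarith [mul_self_nonneg r])
  refine ⟨δ, ?_, h1⟩
  rintro rfl
  simp only [zero_mul] at h2
  have h3 := isEquivalent_zero_iff_eventually_zero.1 h2
  obtain ⟨n, hn, hn3⟩ := (h3.and (eventually_ge_atTop 3)).exists
  have h4 : quadPrimeCount 1 0 1 n = 0 := by simpa using hn
  rw [quadPrimeCount,
    Set.ncard_eq_zero (Set.Finite.subset (Set.finite_Iio n) fun p hp => hp.2.1)] at h4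
  have : 2 ∈ ({p : ℕ | p.Prime ∧ p < n ∧ ∃ x : ℕ, (p : ℤ) = 1 * (x : ℤ) ^ 2 + 0 * (x : ℤ) + 1}) :=
    ⟨Nat.prime_two, by omega, 1, by norm_num⟩
  rw [h4] at this
  exact this

lemma hlFiniteFactor_eq {M : ℤ} (hM2 : 2 ∣ M) (k : ℤ) :
    hlFiniteFactor (M ^ 2) (2 * M * k) = hlFiniteFactor (M ^ 2) 0 := by
  have hg : ∀ z : ℤ, 2 ∣ z → Int.gcd 2 z = 2 := fun z hz => by
    exact_mod_cast Int.gcd_eq_left (by norm_num) hz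
  have h2 : (2 : ℤ) ∣ M ^ 2 := dvd_pow hM2 two_ne_zero
  unfold hlFiniteFactor
  rw [hg _ (dvd_add h2 (by rw [mul_assoc]; exact dvd_mul_right _ _)), hg _ (by simpa using h2)]
  congr 1
  refine Finset.prod_congr ?_ fun _ _ => rfl
  refine Finset.filter_congr fun p hp => ?_
  have hpp := Nat.prime_of_mem_primeFactors hp
  have hpM : (p : ℤ) ∣ M :=
    (Nat.prime_iff_prime_int.1 hpp).dvd_of_dvd_pow
      (Int.natCast_dvd.2 (Nat.dvd_of_mem_primeFactors hp))
  simp only [dvd_zero, and_true, and_iff_left_iff_imp]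
  intro _
  exact Dvd.dvd.mul_right (Dvd.dvd.mul_left hpM _) _

lemma hlFiniteFactor_ne_zero {M : ℤ} (hM2 : 2 ∣ M) (hM : 0 < M) : hlFiniteFactor (M ^ 2) 0 ≠ 0 := by
  have h2 : (2 : ℤ) ∣ M ^ 2 + 0 := by simpa using dvd_pow hM2 two_ne_zero
  have hg : Int.gcd 2 (M ^ 2 + 0) = 2 := by
    exact_mod_cast Int.gcd_eq_left (by norm_num) h2
  have hM' : (0 : ℝ) < M := by exact_mod_cast hM
  unfold hlFiniteFactor
  rw [hg]
  refine mul_ne_zero (div_ne_zero (by norm_num) ?_) (Finset.prod_ne_zero_iff.2 fun p hp => ?_)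
  · push_cast
    positivity
  · have hpp := Nat.prime_of_mem_primeFactors (Finset.mem_filter.1 hp).1
    have h1 : (1 : ℝ) < p := by exact_mod_cast hpp.one_lt
    exact div_ne_zero (by linarith) (by linarith)

/-- For the polynomials `(M x + k)² + α²` the partial products of the Hardy-Littlewood constant
are, up to finitely many Euler factors, those of `x² + 1`. -/
lemma exists_hlPartialProd_eq {M α : ℤ} (hM : M ≠ 0) (hα : α ≠ 0) :
    ∃ C : ℝ, ∀ᶠ n in atTop, ∀ b c : ℤ, b ^ 2 - 4 * M ^ 2 * c = -4 * (M * α) ^ 2 →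
      hlPartialProd 1 0 1 n = C * hlPartialProd (M ^ 2) b c n := by
  classical
  -- `f` and `g` are the Euler factors of the two products, and `r` corrects `g` at the primes
  -- dividing `M α`, where `g p = 1`
  set f : ℕ → ℝ := fun p => 1 - (jacobiSym (-4) p : ℝ) / ((p : ℝ) - 1) with hf
  set r : ℕ → ℝ := fun p => if (p : ℤ) ∣ M * α then f p else 1 with hr
  set g : ℕ → ℝ := fun p => if (p : ℤ) ∣ M ^ 2 then 1 else
    1 - (jacobiSym (-4 * (M * α) ^ 2) p : ℝ) / ((p : ℝ) - 1) with hg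
  set P : ℕ → Finset ℕ := fun n => (Finset.range n).filter (fun p : ℕ => p.Prime ∧ 2 < p) with hP
  have hMα : M * α ≠ 0 := mul_ne_zero hM hα
  set N₀ := (M * α).natAbs + 1
  refine ⟨∏ p ∈ P N₀, r p, ?_⟩
  filter_upwards [eventually_ge_atTop N₀] with n hn b c hbc
  have e1 : hlPartialProd 1 0 1 n = ∏ p ∈ P n, f p := by
    unfold hlPartialProd
    refine Finset.prod_congr (Finset.filter_congr fun p _ => ?_) fun p _ => ?_
    · refine ⟨fun h => ⟨h.1, h.2.1⟩, fun h => ⟨h.1, h.2, fun h1 => ?_⟩⟩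
      have := Int.le_of_dvd one_pos h1
      omega
    · norm_num [hf]
  have e2 : hlPartialProd (M ^ 2) b c n = ∏ p ∈ P n, g p := by
    unfold hlPartialProd
    rw [hbc]
    have : (Finset.range n).filter (fun p : ℕ => p.Prime ∧ 2 < p ∧ ¬ (p : ℤ) ∣ M ^ 2)
        = (P n).filter (fun p : ℕ => ¬ (p : ℤ) ∣ M ^ 2) := by
      rw [hP, Finset.filter_filter]
      refine Finset.filter_congr fun p _ => ?_
      tauto
    rw [this, Finset.prod_filter]
    refine Finset.prod_congr rfl fun p _ => ?_
    by_cases h : (p : ℤ) ∣ M ^ 2 <;> simp [hg, h]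
  have e3 : ∏ p ∈ P N₀, r p = ∏ p ∈ P n, r p := by
    refine Finset.prod_subset ?_ fun p hp hp' => ?_
    · exact Finset.filter_subset_filter _ (Finset.range_mono hn)
    · simp only [hP, Finset.mem_filter, Finset.mem_range, not_and] at hp hp'
      rw [hr]
      refine if_neg fun hd => ?_
      refine hp' ?_ hp.2.1 hp.2.2
      have := Nat.le_of_dvd (Int.natAbs_pos.2 hMα) (Int.natCast_dvd.1 hd)
      omega
  rw [e1, e2, e3, ← Finset.prod_mul_distrib]
  refine Finset.prod_congr rfl fun p hp => ?_
  have hpp : p.Prime := (Finset.mem_filter.1 hp).2.1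
  have hpi := Nat.prime_iff_prime_int.1 hpp
  have : NeZero p := ⟨hpp.ne_zero⟩
  simp only [hr, hg]
  by_cases h1 : (p : ℤ) ∣ M
  · rw [if_pos (h1.mul_right _), if_pos (dvd_pow h1 two_ne_zero), mul_one]
  have h1' : ¬ (p : ℤ) ∣ M ^ 2 := fun h => h1 (hpi.dvd_of_dvd_pow h)
  rw [if_neg h1']
  by_cases h2 : (p : ℤ) ∣ α
  · rw [if_pos (h2.mul_left _)]
    have : jacobiSym (-4 * (M * α) ^ 2) p = 0 := by
      rw [jacobiSym.eq_zero_iff_not_coprime]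
      intro h
      have hd : (p : ℤ) ∣ (Int.gcd (-4 * (M * α) ^ 2) p : ℕ) :=
        Int.dvd_coe_gcd (((h2.mul_left _).pow two_ne_zero).mul_left _) dvd_rfl
      rw [h] at hd
      exact hpi.not_isUnit (isUnit_of_dvd_one (by simpa using hd))
    rw [this]
    simp
  · have h3 : ¬ (p : ℤ) ∣ M * α := fun h => (hpi.dvd_or_dvd h).elim h1 h2
    rw [if_neg h3, one_mul, jacobiSym.mul_left, jacobiSym.sq_one', mul_one]
    have := (Nat.Prime.coprime_iff_not_dvd hpp).2 (fun h => h3 (Int.natCast_dvd.2 h))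
    rw [Int.gcd_comm]
    simpa [Int.gcd] using this

/-- Under the Hardy-Littlewood conjecture the primes `(M t + k)² + α²` have the same nonzero
density for all admissible residues `k` modulo `M`. -/
lemma exists_class_density (hHL : HardyLittlewoodConjecture) {M α : ℤ} (hM2 : 2 ∣ M) (hM : 0 < M)
    (hα : α ≠ 0) {k₀ : ℤ} (hk₀ : IsCoprime (α ^ 2 + k₀ ^ 2) M) :
    ∃ δ : ℝ, δ ≠ 0 ∧ ∀ k : ℤ, IsCoprime (α ^ 2 + k ^ 2) M →
      Tendsto (fun n => (quadPrimeCount (M ^ 2) (2 * M * k) (k ^ 2 + α ^ 2) n : ℝ) / hlScale n)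
        atTop (𝓝 δ) := by
  have hΔ : ∀ k : ℤ, (2 * M * k) ^ 2 - 4 * M ^ 2 * (k ^ 2 + α ^ 2) = -4 * (M * α) ^ 2 :=
    fun k => by ring
  have hex : ∀ k : ℤ, IsCoprime (α ^ 2 + k ^ 2) M → ∃ δ : ℝ,
      IsHLConstant (M ^ 2) (2 * M * k) (k ^ 2 + α ^ 2) δ ∧
      (fun n : ℕ => (quadPrimeCount (M ^ 2) (2 * M * k) (k ^ 2 + α ^ 2) n : ℝ)) ~[atTop]
        (fun n : ℕ => δ * hlScale n) := fun k hk => by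
    refine hHL _ _ _ (by positivity) ?_ ?_ ?_
    · rw [← Int.isCoprime_iff_gcd_eq_one, add_comm]
      exact (IsCoprime.pow_right (n := 2) hk).symm.of_isCoprime_of_dvd_left (Int.gcd_dvd_left ..)
    · rintro ⟨-, h⟩
      have h2 : IsUnit (2 : ℤ) := hk.isUnit_of_dvd' (by rw [add_comm]; exact h.two_dvd) hM2
      exact absurd h2 (by decide)
    · rw [hΔ]
      rintro ⟨s, hs⟩
      have : 0 < (M * α) ^ 2 := by have := mul_ne_zero hM.ne' hα; positivity
      nlinarith [mul_self_nonneg s]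
  obtain ⟨δ₁, hδ₁, hc₁⟩ := exists_ne_zero_hlConstant hHL
  obtain ⟨C, hC⟩ := exists_hlPartialProd_eq hM.ne' hα
  have hF := hlFiniteFactor_ne_zero hM2 hM
  have hconst : ∀ k δ, IsHLConstant (M ^ 2) (2 * M * k) (k ^ 2 + α ^ 2) δ →
      δ₁ = hlFiniteFactor 1 0 * C / hlFiniteFactor (M ^ 2) 0 * δ := fun k δ h => by
    rw [IsHLConstant, hlFiniteFactor_eq hM2] at h
    refine tendsto_nhds_unique hc₁ ((h.const_mul
      (hlFiniteFactor 1 0 * C / hlFiniteFactor (M ^ 2) 0)).congr' ?_)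
    filter_upwards [hC] with n hn
    rw [hn _ _ (hΔ k)]
    field_simp
  set E := hlFiniteFactor 1 0 * C / hlFiniteFactor (M ^ 2) 0
  -- the conjecture for one admissible class and the constant of `x² + 1` show that the finitely
  -- many correcting factors do not vanish
  have hE : E ≠ 0 := by
    obtain ⟨δ, h, -⟩ := hex k₀ hk₀
    intro h0
    apply hδ₁
    rw [hconst k₀ δ h, h0, zero_mul]
  refine ⟨δ₁ / E, div_ne_zero hδ₁ hE, fun k hk => ?_⟩
  obtain ⟨δ, h1, h2⟩ := hex k hk
  have hδ : δ₁ / E = δ := by rw [hconst k δ h1, mul_div_cancel_left₀ _ hE]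
  rw [hδ]
  have h3 := h2.div (IsEquivalent.refl (u := hlScale))
  refine (h3.symm.tendsto_nhds ?_)
  refine (tendsto_const_nhds (x := δ)).congr' ?_
  filter_upwards [hlScale_ne_zero] with n hn
  simp only [Pi.div_apply]
  field_simp

/-- If, up to finitely many exceptions, the primes `p = α² + x²` with property `R` are those
with `x` in a set `G` of admissible residues modulo `M`, then the density of `R` is `#G` times the
density of a class. -/
lemma tendsto_count_of_residues {M : ℕ} {α : ℤ} {δ : ℝ} (G : Finset ℕ)
    (hG : ∀ k ∈ G, k < M)
    (hδ : ∀ k ∈ G, Tendsto (fun n =>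
      (quadPrimeCount ((M : ℤ) ^ 2) (2 * M * k) ((k : ℤ) ^ 2 + α ^ 2) n : ℝ)
      / hlScale n) atTop (𝓝 δ))
    (R : ℕ → Prop) (C : ℕ)
    (hR : ∀ p : ℕ, p.Prime → C < p → ∀ x : ℕ, (p : ℤ) = α ^ 2 + (x : ℤ) ^ 2 →
      (R p ↔ x % M ∈ G)) :
    Tendsto (fun N => (({p | p ∈ primesQ α N ∧ R p} : Set ℕ).ncard : ℝ) / hlScale (N + 1)) atTop
      (𝓝 (G.card * δ)) := by
  classical
  -- the primes `< n` in the class `k`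
  set A : ℕ → ℕ → Set ℕ := fun k n => {p : ℕ | p.Prime ∧ p < n ∧ ∃ x : ℕ,
    (p : ℤ) = (M : ℤ) ^ 2 * (x : ℤ) ^ 2 + 2 * M * k * (x : ℤ) + ((k : ℤ) ^ 2 + α ^ 2)} with hA
  have hAfin : ∀ k n, (A k n).Finite := fun k n =>
    Set.Finite.subset (Set.finite_Iio n) fun p hp => hp.2.1
  have hAmem : ∀ k n p, p ∈ A k n → ∃ x : ℕ, (p : ℤ) = α ^ 2 + ((M * x + k : ℕ) : ℤ) ^ 2 := by
    rintro k n p ⟨-, -, x, hx⟩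
    refine ⟨x, ?_⟩
    rw [hx]; push_cast; ring
  have hdisj : ∀ n, (G : Set ℕ).PairwiseDisjoint (fun k => (hAfin k n).toFinset) := by
    intro n k hk k' hk' hne
    rw [Function.onFun, Finset.disjoint_left]
    intro p hp hp'
    rw [Set.Finite.mem_toFinset] at hp hp'
    obtain ⟨x, hx⟩ := hAmem k n p hp
    obtain ⟨x', hx'⟩ := hAmem k' n p hp'
    have h1 : ((M * x + k : ℕ) : ℤ) ^ 2 = ((M * x' + k' : ℕ) : ℤ) ^ 2 := by linarith
    have h2 : M * x + k = M * x' + k' := by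
      have : (M * x + k) ^ 2 = (M * x' + k') ^ 2 := by exact_mod_cast h1
      exact Nat.pow_left_injective two_ne_zero this
    apply hne
    have h3 := congrArg (· % M) h2
    simpa [Nat.mul_add_mod, Nat.mod_eq_of_lt (hG k hk), Nat.mod_eq_of_lt (hG k' hk')] using h3
  -- the classes are disjoint, and their union differs from the primes counted by at most `C + 1`
  set U : ℕ → Finset ℕ := fun n => G.biUnion (fun k => (hAfin k n).toFinset) with hU
  have hUcard : ∀ n, ((U n).card : ℝ) =
      ∑ k ∈ G, (quadPrimeCount ((M : ℤ) ^ 2) (2 * M * k) ((k : ℤ) ^ 2 + α ^ 2) n : ℝ) := fun n => by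
    rw [hU, Finset.card_biUnion (hdisj n)]
    push_cast
    refine Finset.sum_congr rfl fun k _ => ?_
    rw [quadPrimeCount, Set.ncard_eq_toFinset_card _ (hAfin k n)]
  set T : ℕ → Set ℕ := fun N => {p | p ∈ primesQ α N ∧ R p} with hT
  have hTfin : ∀ N, (T N).Finite := fun N =>
    Set.Finite.subset (Set.finite_Iic N) fun p hp => hp.1.2.1
  have hTU : ∀ N, (hTfin N).toFinset ⊆ U (N + 1) ∪ Finset.range (C + 1) := by
    intro N p hp
    rw [Set.Finite.mem_toFinset] at hp
    obtain ⟨⟨hpp, hpN, x, hx⟩, hRp⟩ := hp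
    rw [Finset.mem_union, Finset.mem_range]
    by_cases hpC : C < p
    · left
      have hx' : (p : ℤ) = α ^ 2 + ((x.natAbs : ℕ) : ℤ) ^ 2 := by rw [hx, Int.natAbs_sq]
      rw [hU, Finset.mem_biUnion]
      refine ⟨x.natAbs % M, (hR p hpp hpC _ hx').1 hRp, ?_⟩
      rw [Set.Finite.mem_toFinset]
      refine ⟨hpp, by omega, x.natAbs / M, ?_⟩
      rw [hx']
      conv_lhs => rw [← Nat.div_add_mod x.natAbs M]
      push_cast
      ring
    · right; omega
  have hUT : ∀ N, U (N + 1) ⊆ (hTfin N).toFinset ∪ Finset.range (C + 1) := by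
    intro N p hp
    rw [hU, Finset.mem_biUnion] at hp
    obtain ⟨k, hk, hp⟩ := hp
    rw [Set.Finite.mem_toFinset] at hp
    rw [Finset.mem_union, Finset.mem_range, Set.Finite.mem_toFinset]
    by_cases hpC : C < p
    · left
      obtain ⟨x, hx⟩ := hAmem k _ p hp
      refine ⟨⟨hp.1, by have := hp.2.1; omega, _, hx⟩, (hR p hp.1 hpC _ hx).2 ?_⟩
      rwa [Nat.mul_add_mod, Nat.mod_eq_of_lt (hG k hk)]
    · right; omega
  have hdiff : ∀ N, |((T N).ncard : ℝ) - (U (N + 1)).card| ≤ C + 1 := by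
    intro N
    have h1 := (Finset.card_le_card (hTU N)).trans (Finset.card_union_le _ _)
    have h2 := (Finset.card_le_card (hUT N)).trans (Finset.card_union_le _ _)
    rw [Finset.card_range, ← Set.ncard_eq_toFinset_card _ (hTfin N)] at h1 h2
    have h1' : ((T N).ncard : ℝ) ≤ (U (N + 1)).card + (C + 1) := by exact_mod_cast h1
    have h2' : ((U (N + 1)).card : ℝ) ≤ (T N).ncard + (C + 1) := by exact_mod_cast h2
    rw [abs_le]
    constructor <;> linarith
  have hscale : Tendsto (fun N => hlScale (N + 1)) atTop atTop :=
    tendsto_hlScale.comp (tendsto_add_atTop_nat 1)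
  have hmain : Tendsto (fun N => ((U (N + 1)).card : ℝ) / hlScale (N + 1)) atTop
      (𝓝 (G.card * δ)) := by
    have h1 := (tendsto_finsetSum G hδ).comp (tendsto_add_atTop_nat 1)
    rw [Finset.sum_const, nsmul_eq_mul] at h1
    refine h1.congr fun N => ?_
    simp only [Function.comp]
    rw [hUcard, Finset.sum_div]
  have herr : Tendsto (fun N => (((T N).ncard : ℝ) - (U (N + 1)).card) / hlScale (N + 1)) atTop
      (𝓝 0) := by
    refine squeeze_zero_norm' (a := fun N => ((C : ℝ) + 1) / hlScale (N + 1)) ?_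
      (hscale.const_div_atTop _)
    filter_upwards [hscale.eventually_gt_atTop 0] with N hN
    rw [norm_div, Real.norm_eq_abs, Real.norm_of_nonneg hN.le]
    exact div_le_div_of_nonneg_right (hdiff N) hN.le
  have := hmain.add herr
  rw [add_zero] at this
  refine this.congr fun N => ?_
  rw [← add_div]
  congr 1
  ring

/-! ### Trace densities as products of local factors -/

lemma globSymbol_mod {α : ℤ} {L : Finset ℕ} (K : ℕ) (e : ℕ → ℕ) (x : ℕ) :
    globSymbol α L K e (x % (8 * ∏ l ∈ L, l)) = globSymbol α L K e x := by
  unfold globSymbol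
  congr 1
  · rw [giPow, giPow]
    have h : x % (8 * ∏ l ∈ L, l) % 8 = x % 8 := Nat.mod_mul_right_mod x 8 _
    congr 3
    omega
  · refine Finset.prod_congr rfl fun l hl => ?_
    have h : l ∣ 8 * ∏ l ∈ L, l := (Finset.dvd_prod_of_mem (fun l => l) hl).mul_left 8
    rw [← locSymbol_mod l, Nat.mod_mod_of_dvd _ h, locSymbol_mod]

/-- The exponent of `i` contributed to the symbol by `s = ±1`, by `2 ^ σ` and by the sign
`(-1) ^ (x / 2)` of the Jacobi sum. -/
def signExp (s : ℤ) (σ : ℕ) : ℕ := σ + 2 + if s = -1 then 2 else 0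

lemma quartChar_eq_globSymbol {p : ℕ} [Fact p.Prime] (hp : p % 4 = 1) {f : ZMod p}
    (hf : f * f = -1) {L : Finset ℕ} (hL : ∀ l ∈ L, l.Prime ∧ l % 2 = 1) (hLp : ∀ l ∈ L, l ≠ p)
    {α : ℤ} {y : ℕ} (hα : α % 4 = 1) (hpx : (p : ℤ) = α ^ 2 + (2 * (y : ℤ)) ^ 2)
    (hfx : (α : ZMod p) + (2 * (y : ℤ) : ℤ) * f = 0) {D s : ℤ} (hs : s = 1 ∨ s = -1) {σ : ℕ}
    {e : ℕ → ℕ} (hD : -D = s * 2 ^ σ * ∏ l ∈ L, (sgn4 l * l) ^ e l) :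
    (-1) ^ (y : ℤ).natAbs * quartChar p hp f hf (-(D : ZMod p))
      = globSymbol α L (signExp s σ) e (2 * y) := by
  have hcast : (-(D : ZMod p)) = (s : ZMod p) * 2 ^ σ *
      ∏ l ∈ L, ((sgn4 l * l : ℤ) : ZMod p) ^ e l := by
    have := congrArg (Int.cast : ℤ → ZMod p) hD
    push_cast at this ⊢
    exact this
  have hsχ : quartChar p hp f hf (s : ZMod p) = giPow y ^ (if s = -1 then 2 else 0) := by
    rcases hs with rfl | rfl
    · simp
    · rw [if_pos rfl, ← quartChar_neg_one hp hf hα hpx]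
      simp
  rw [hcast, map_mul, map_mul, map_prod, map_pow, hsχ, quartChar_two hp hf hα hpx hfx,
    neg_one_pow_natAbs_eq, globSymbol, Nat.mul_div_cancel_left _ two_pos, signExp, pow_add, pow_add,
    Finset.prod_congr rfl fun l hl => by
      rw [map_pow, quartChar_eq_locSymbol hp hf (hL l hl).1 (hL l hl).2 (hLp l hl) hα hpx hfx]]
  ring

lemma curveE_Δ (D : ℤ) : (curveE D).Δ = -64 * D ^ 3 := by
  simp [curveE, WeierstrassCurve.Δ, WeierstrassCurve.b₂, WeierstrassCurve.b₄, WeierstrassCurve.b₆,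
    WeierstrassCurve.b₈]
  ring

/-- For all large primes `p = α² + x²`, the residue of `x` modulo `8 ∏ l` is admissible, and it
decides whether the trace of Frobenius is `2 α` or `-2 α`. -/
lemma trace_iff_residue {α : ℤ} (hα : α % 4 = 1) {L : Finset ℕ}
    (hL : ∀ l ∈ L, l.Prime ∧ l % 2 = 1) {D s : ℤ} (hD0 : D ≠ 0) (hs : s = 1 ∨ s = -1) {σ : ℕ}
    {e : ℕ → ℕ} (hD : -D = s * 2 ^ σ * ∏ l ∈ L, (sgn4 l * l) ^ e l) {p : ℕ} (hp : p.Prime)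
    (hpC : 8 * ∏ l ∈ L, l + (curveE D).Δ.natAbs < p) {x : ℕ}
    (hpx : (p : ℤ) = α ^ 2 + (x : ℤ) ^ 2) :
    x % (8 * ∏ l ∈ L, l) ∈ admissible α L ∧ ∀ t : ℤ, t = 1 ∨ t = -1 →
      ((¬ (p : ℤ) ∣ (curveE D).Δ ∧ frobTrace D p = 2 * (t * α)) ↔
        globSymbol α L (signExp s σ) e (x % (8 * ∏ l ∈ L, l)) = t) := by
  have := Fact.mk hp
  have hPpos : 0 < ∏ l ∈ L, l := Finset.prod_pos fun l hl => (hL l hl).1.pos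
  have hΔ0 : (curveE D).Δ ≠ 0 := by rw [curveE_Δ]; positivity
  have hgood : ¬ (p : ℤ) ∣ (curveE D).Δ := fun h => by
    have := Nat.le_of_dvd (Int.natAbs_pos.2 hΔ0) (Int.natCast_dvd.1 h)
    omega
  have hDp : (D : ZMod p) ≠ 0 := by
    rw [Ne, ZMod.intCast_zmod_eq_zero_iff_dvd]
    intro h
    apply hgood
    rw [curveE_Δ]
    exact (dvd_pow h three_ne_zero).mul_left _
  have hp2 : p % 2 = 1 := by
    rcases hp.eq_two_or_odd with h | h
    · omega
    · exact h
  -- `p` and `α` are odd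
  have hx2 : x % 2 = 0 := by
    by_contra hx
    have h1 : (α ^ 2 + (x : ℤ) ^ 2) % 2 = 0 := by
      have hα2 : Odd (α ^ 2) := (Int.odd_iff.2 (by omega)).pow
      have hx2 : Odd ((x : ℤ) ^ 2) := (Int.odd_iff.2 (by omega)).pow
      exact Int.even_iff.1 (hα2.add_odd hx2)
    omega
  obtain ⟨y, rfl⟩ : ∃ y, x = 2 * y := ⟨x / 2, by omega⟩
  have hpx' : (p : ℤ) = α ^ 2 + (2 * (y : ℤ)) ^ 2 := by rw [hpx]; push_cast; ring
  have hp4 : p % 4 = 1 := by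
    obtain ⟨j, hj⟩ : ∃ j, α = 4 * j + 1 := ⟨α / 4, by omega⟩
    have : (p : ℤ) = 4 * (4 * j ^ 2 + 2 * j + (y : ℤ) ^ 2) + 1 := by rw [hpx', hj]; ring
    omega
  have hx0 : ((2 * (y : ℤ) : ℤ) : ZMod p) ≠ 0 := by
    intro h
    rw [ZMod.intCast_zmod_eq_zero_iff_dvd] at h
    have h1 : (p : ℤ) ∣ α := by
      have : (p : ℤ) ∣ α ^ 2 := by
        rw [show α ^ 2 = p - (2 * (y : ℤ)) ^ 2 by rw [hpx']; ring]
        exact dvd_sub dvd_rfl (dvd_pow h two_ne_zero)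
      exact (Nat.prime_iff_prime_int.1 hp).dvd_of_dvd_pow this
    have h2 := Int.dvd_coe_gcd h1 h
    rw [gcd_eq_one_of_prime_sum hpx'] at h2
    exact (Nat.prime_iff_prime_int.1 hp).not_isUnit (isUnit_of_dvd_one (by simpa using h2))
  -- reduction modulo the prime `α + x i` sends `i` to `f = -α / x`
  set f : ZMod p := -α / ((2 * (y : ℤ) : ℤ) : ZMod p) with hf'
  have hfx : (α : ZMod p) + (2 * (y : ℤ) : ℤ) * f = 0 := by
    rw [hf']; field_simp; ring
  have hf : f * f = -1 := by
    have h0 : ((α ^ 2 + (2 * (y : ℤ)) ^ 2 : ℤ) : ZMod p) = 0 := by rw [← hpx']; simp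
    rw [Int.cast_add, Int.cast_pow, Int.cast_pow] at h0
    rw [hf', div_mul_div_comm, div_eq_iff (mul_ne_zero hx0 hx0)]
    linear_combination h0
  have hlt : ∀ l ∈ L, l < p := fun l hl => by
    have := Nat.le_of_dvd hPpos (Finset.dvd_prod_of_mem (fun l => l) hl)
    omega
  refine ⟨?_, fun t ht => ?_⟩
  · rw [admissible, Finset.mem_filter, Finset.mem_range]
    refine ⟨Nat.mod_lt _ (by omega), ?_, fun l hl h => ?_⟩
    · rw [Nat.dvd_mod_iff (Dvd.dvd.mul_right (by norm_num) _)]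
      exact dvd_mul_right 2 y
    · have hlM : l ∣ 8 * ∏ l ∈ L, l := (Finset.dvd_prod_of_mem (fun l => l) hl).mul_left 8
      have h1 : (l : ℤ) ∣ (p : ℤ) := by
        rw [hpx, ← ZMod.intCast_zmod_eq_zero_iff_dvd]
        rw [← ZMod.intCast_zmod_eq_zero_iff_dvd] at h
        have h2 : ((2 * y % (8 * ∏ l ∈ L, l) : ℕ) : ZMod l) = ((2 * y : ℕ) : ZMod l) := by
          rw [ZMod.natCast_eq_natCast_iff']
          exact Nat.mod_mod_of_dvd _ hlM
        rw [Int.cast_add, Int.cast_pow, Int.cast_pow, Int.cast_natCast] at h ⊢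
        rwa [h2] at h
      have h3 := (Nat.prime_dvd_prime_iff_eq (hL l hl).1 hp).1 (by exact_mod_cast h1)
      exact (hlt l hl).ne h3
  · rw [globSymbol_mod]
    obtain ⟨h1, h2⟩ := frobTrace_eq_iff hp4 hf hα hpx' hfx D hgood hDp
    rw [quartChar_eq_globSymbol hp4 hf hL (fun l hl => (hlt l hl).ne) hα hpx' hfx hs hD] at h1 h2
    rcases ht with rfl | rfl
    · rw [and_iff_right hgood, one_mul, h1, Int.cast_one]
    · rw [and_iff_right hgood, neg_one_mul, h2, Int.cast_neg, Int.cast_one]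

lemma primesQ_neg (α : ℤ) (N : ℕ) : primesQ (-α) N = primesQ α N := by
  simp [primesQ]

/-- The trace densities as proportions of admissible residues. -/
lemma hasTraceDensity_of_residues (hHL : HardyLittlewoodConjecture) {α : ℤ} (hα : α % 4 = 1)
    {L : Finset ℕ} (hL : ∀ l ∈ L, l.Prime ∧ l % 2 = 1) {D s : ℤ} (hD0 : D ≠ 0)
    (hs : s = 1 ∨ s = -1) {σ : ℕ} {e : ℕ → ℕ}
    (hD : -D = s * 2 ^ σ * ∏ l ∈ L, (sgn4 l * l) ^ e l) {t : ℤ} (ht : t = 1 ∨ t = -1) :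
    HasTraceDensity D (t * α)
      ((((admissible α L).filter (fun x => globSymbol α L (signExp s σ) e x = t)).card : ℝ)
        / (admissible α L).card) := by
  set M := 8 * ∏ l ∈ L, l with hM
  have hPpos : 0 < ∏ l ∈ L, l := Finset.prod_pos fun l hl => (hL l hl).1.pos
  have hcardpos : 0 < (admissible α L).card := by
    have h := card_admissible (α := α) hL
    have h2 : 0 < ∏ l ∈ L, locCount α l :=
      Finset.prod_pos fun l hl => locCount_pos (hL l hl).2 (hL l hl).1.one_lt α
    omega
  have hcop : ∀ k ∈ admissible α L, IsCoprime (α ^ 2 + (k : ℤ) ^ 2) (M : ℤ) := by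
    intro k hk
    obtain ⟨-, hk2, hkL⟩ := Finset.mem_filter.1 hk
    rw [hM]
    push_cast
    refine IsCoprime.mul_right ?_ (IsCoprime.prod_right fun l hl => ?_)
    · have h2 : IsCoprime (α ^ 2 + (k : ℤ) ^ 2) 2 := by
        have hodd : Odd (α ^ 2 + (k : ℤ) ^ 2) := by
          have h1 : Odd (α ^ 2) := (Int.odd_iff.2 (by omega)).pow
          have h3 : Even ((k : ℤ) ^ 2) := (Int.even_iff.2 (by omega)).pow_of_ne_zero two_ne_zero
          exact h1.add_even h3
        exact (Int.isCoprime_two_left.2 hodd).symm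
      exact h2.pow_right (n := 3)
    · exact (((Nat.prime_iff_prime_int.1 (hL l hl).1).coprime_iff_not_dvd).2 (hkL l hl)).symm
  obtain ⟨k₀, hk₀⟩ := Finset.card_pos.1 hcardpos
  obtain ⟨δ, hδ0, hδ⟩ := exists_class_density hHL (M := (M : ℤ)) (α := α)
    (by rw [hM]; push_cast; exact Dvd.dvd.mul_right (by norm_num) _)
    (by rw [hM]; exact_mod_cast Nat.mul_pos (by norm_num) hPpos) (by rintro rfl; simp at hα)
    (hcop k₀ hk₀)
  have hlt : ∀ k ∈ admissible α L, k < M := fun k hk =>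
    Finset.mem_range.1 (Finset.mem_filter.1 hk).1
  set G := (admissible α L).filter (fun x => globSymbol α L (signExp s σ) e x = t) with hG
  -- both counts, divided by `√N / log N`, converge, and the common density cancels
  have h1 := tendsto_count_of_residues (admissible α L) hlt (fun k hk => hδ k (hcop k hk))
    (fun _ => True) (M + (curveE D).Δ.natAbs) (fun p hp hpC x hx =>
      iff_of_true trivial (trace_iff_residue hα hL hD0 hs hD hp hpC hx).1)
  have h2 := tendsto_count_of_residues G (fun k hk => hlt k (Finset.mem_filter.1 hk).1)
    (fun k hk => hδ k (hcop k (Finset.mem_filter.1 hk).1))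
    (fun p => ¬ (p : ℤ) ∣ (curveE D).Δ ∧ frobTrace D p = 2 * (t * α))
    (M + (curveE D).Δ.natAbs) (fun p hp hpC x hx => by
      obtain ⟨h3, h4⟩ := trace_iff_residue hα hL hD0 hs hD hp hpC hx
      rw [h4 t ht, hG, Finset.mem_filter, and_iff_right h3])
  have hQ : ∀ N, primesQ (t * α) N = primesQ α N := fun N => by
    rcases ht with rfl | rfl
    · rw [one_mul]
    · rw [neg_one_mul, primesQ_neg]
  have hcard0 : ((admissible α L).card : ℝ) ≠ 0 := by exact_mod_cast hcardpos.ne'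
  have h3 := h2.div h1 (mul_ne_zero hcard0 hδ0)
  rw [mul_div_mul_right _ _ hδ0] at h3
  refine h3.congr' ?_
  filter_upwards [(tendsto_add_atTop_nat 1).eventually hlScale_ne_zero] with N hN
  simp only [Pi.div_apply, and_true, Set.ofPred_mem_eq]
  rw [div_div_div_cancel_right₀ hN]
  unfold primesTrace
  simp only [hQ]

/-- The trace densities as products of local factors. -/
lemma hasTraceDensity_of_local (hHL : HardyLittlewoodConjecture) {α : ℤ} (hα : α % 4 = 1)
    {L : Finset ℕ} (hL : ∀ l ∈ L, l.Prime ∧ l % 2 = 1) {D s : ℤ} (hD0 : D ≠ 0)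
    (hs : s = 1 ∨ s = -1) {σ : ℕ} {e : ℕ → ℕ}
    (hD : -D = s * 2 ^ σ * ∏ l ∈ L, (sgn4 l * l) ^ e l) {t : ℤ} (ht : t = 1 ∨ t = -1) :
    HasTraceDensity D (t * α) (1 / 4 * (1
      + (if 4 ∣ 2 * signExp s σ then 1 else 0)
        * ∏ l ∈ L, ((locSum α l (2 * e l) : ℝ) / locCount α l)
      + 2 * t * ((if 4 ∣ signExp s σ then 1 else 0)
        * ∏ l ∈ L, ((locSum α l (e l) : ℝ) / locCount α l)))) := by
  have h := hasTraceDensity_of_residues hHL hα hL hD0 hs hD ht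
  have h1 := congrArg (Int.cast : ℤ → ℝ) (card_globSymbol_eq (α := α) hL (signExp s σ) e t ht)
  have h2 := congrArg (Int.cast : ℤ → ℝ) (card_admissible (α := α) hL)
  push_cast at h1 h2
  have hn : (∏ l ∈ L, (locCount α l : ℝ)) ≠ 0 := by
    refine Finset.prod_ne_zero_iff.2 fun l hl => ?_
    exact_mod_cast (locCount_pos (hL l hl).2 (hL l hl).1.one_lt α).ne'
  convert h using 1
  rw [h2, Finset.prod_div_distrib, Finset.prod_div_distrib]
  rw [eq_div_iff (by simpa using hn)]
  field_simp
  split_ifs at h1 ⊢ <;> linear_combination (-1 / 4 : ℝ) * h1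

/-! ### Evaluation of the local factors -/

section factorization

variable {R : Type*} [CommMonoid R]

lemma factorization_prod_mul {a b : ℕ} (hab : a.Coprime b) (F : ℕ → ℕ → R) :
    (a * b).factorization.prod F = a.factorization.prod F * b.factorization.prod F := by
  rw [Nat.factorization_mul_of_coprime hab, Finsupp.prod_add_index_of_disjoint]
  exact hab.disjoint_primeFactors

lemma factorization_prod_pow {a k : ℕ} (ha : Squarefree a) (hk : k ≠ 0) (F : ℕ → ℕ → R) :
    (a ^ k).factorization.prod F = ∏ l ∈ a.primeFactors, F l k := by
  rw [Finsupp.prod, Nat.support_factorization, Nat.primeFactors_pow _ hk]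
  refine Finset.prod_congr rfl fun l hl => ?_
  have hlp := Nat.prime_of_mem_primeFactors hl
  rw [Nat.factorization_pow, Finsupp.smul_apply,
    Nat.factorization_eq_one_of_squarefree ha hlp (Nat.dvd_of_mem_primeFactors hl)]
  simp

lemma factorization_prod_cubefull {a b c : ℕ} (ha : Squarefree a) (hb : Squarefree b)
    (hc : Squarefree c) (hab : a.Coprime b) (hac : a.Coprime c) (hbc : b.Coprime c)
    (F : ℕ → ℕ → R) :
    (a * b ^ 2 * c ^ 3).factorization.prod F =
      (∏ l ∈ a.primeFactors, F l 1) * (∏ l ∈ b.primeFactors, F l 2)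
        * ∏ l ∈ c.primeFactors, F l 3 := by
  rw [factorization_prod_mul (Nat.Coprime.mul_left (hac.pow_right 3) (hbc.pow 2 3)),
    factorization_prod_mul (hab.pow_right 2), factorization_prod_pow hb two_ne_zero,
    factorization_prod_pow hc three_ne_zero]
  have := factorization_prod_pow ha one_ne_zero F
  rw [pow_one] at this
  rw [this]

end factorization

lemma locCount_eq_tau {α : ℤ} {l : ℕ} (hl : l % 2 = 1) (hα : ¬ (l : ℤ) ∣ α) :
    (locCount α l : ℝ) = tau l := by
  rw [locCount, if_neg hα, tau]
  rcases sgn4_cases hl with ⟨-, h, hm⟩ | ⟨-, h, hm⟩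
  · rw [if_pos h]
    generalize (l + 1) / 4 = m at hm ⊢
    rw [← hm]
    push_cast
    ring
  · rw [if_neg (by omega)]
    generalize (l + 1) / 4 = m at hm ⊢
    have : (4 * m : ℝ) = l + 1 := by exact_mod_cast hm
    push_cast
    linarith

lemma locRatio_of_dvd {α : ℤ} {l : ℕ} (hl1 : 1 < l) (hα : (l : ℤ) ∣ α) (e : ℕ) :
    (locSum α l e : ℝ) / locCount α l = (-1) ^ ((l + 1) / 4 * e) := by
  rw [locSum, locCount, if_pos hα, if_pos hα]
  have : (1 : ℝ) < l := by exact_mod_cast hl1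
  push_cast
  rw [mul_div_cancel_left₀ _ (by linarith)]

lemma locRatio_of_not_dvd {α : ℤ} {l : ℕ} (hl : l % 2 = 1) (hα : ¬ (l : ℤ) ∣ α) {e : ℕ}
    (he : ¬ 4 ∣ e) : (locSum α l e : ℝ) / locCount α l = -(-1) ^ ((l + 1) / 4 * e) / tau l := by
  rw [locCount_eq_tau hl hα, locSum, if_neg hα, if_neg he]
  push_cast
  ring

lemma locRatio_four {α : ℤ} {l : ℕ} (hl : l % 2 = 1) (hl1 : 1 < l) :
    (locSum α l 4 : ℝ) / locCount α l = 1 := by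
  have h0 : (locCount α l : ℝ) ≠ 0 := by exact_mod_cast (locCount_pos hl hl1 α).ne'
  rw [div_eq_one_iff_eq h0]
  have : locSum α l 4 = locCount α l := by
    have hev : Even ((l + 1) / 4 * 4) := ⟨(l + 1) / 4 * 2, by ring⟩
    rw [locSum, locCount, hev.neg_one_pow]
    simp
  rw [this]

lemma neg_one_pow_quarter {l : ℕ} (hl : l % 2 = 1) {e : ℕ} (he : Odd e) :
    (-1 : ℝ) ^ ((l + 1) / 4 * e) =
      (if l % 8 = 3 then -1 else 1) * (if l % 8 = 5 then -1 else 1) := by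
  rw [mul_comm, pow_mul, he.neg_one_pow]
  have h8 : l % 8 = 1 ∨ l % 8 = 3 ∨ l % 8 = 5 ∨ l % 8 = 7 := by omega
  rcases h8 with h | h | h | h <;> rw [h]
  · rw [Even.neg_one_pow (Nat.even_iff.2 (by omega))]; norm_num
  · rw [Odd.neg_one_pow (Nat.odd_iff.2 (by omega))]; norm_num
  · rw [Odd.neg_one_pow (Nat.odd_iff.2 (by omega))]; norm_num
  · rw [Even.neg_one_pow (Nat.even_iff.2 (by omega))]; norm_num

lemma neg_neg_one_pow_quarter {l : ℕ} (hl : l % 2 = 1) {e : ℕ} (he : Odd e) :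
    -(-1 : ℝ) ^ ((l + 1) / 4 * e) =
      (if l % 8 = 1 then -1 else 1) * (if l % 8 = 7 then -1 else 1) := by
  rw [neg_one_pow_quarter hl he]
  have h8 : l % 8 = 1 ∨ l % 8 = 3 ∨ l % 8 = 5 ∨ l % 8 = 7 := by omega
  rcases h8 with h | h | h | h <;> rw [h] <;> norm_num

lemma prod_ite_mod_eight (i n : ℕ) :
    ∏ l ∈ n.primeFactors, (if l % 8 = i then (-1 : ℝ) else 1) = (-1) ^ numPrimesMod8 i n := by
  rw [← Finset.prod_filter, Finset.prod_const, numPrimesMod8]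

section products

variable {α : ℤ} {n : ℕ}

lemma prod_locRatio_even_of_dvd (hα : ∀ l ∈ n.primeFactors, (l : ℤ) ∣ α) {e : ℕ} (he : Even e) :
    ∏ l ∈ n.primeFactors, ((locSum α l e : ℝ) / locCount α l) = 1 :=
  Finset.prod_eq_one fun l hl => by
    rw [locRatio_of_dvd (Nat.prime_of_mem_primeFactors hl).one_lt (hα l hl),
      (he.mul_left _).neg_one_pow]

lemma prod_locRatio_odd_of_dvd (hn : ∀ l ∈ n.primeFactors, l % 2 = 1)
    (hα : ∀ l ∈ n.primeFactors, (l : ℤ) ∣ α) {e : ℕ} (he : Odd e) :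
    ∏ l ∈ n.primeFactors, ((locSum α l e : ℝ) / locCount α l)
      = (-1) ^ numPrimesMod8 3 n * (-1) ^ numPrimesMod8 5 n := by
  rw [← prod_ite_mod_eight, ← prod_ite_mod_eight, ← Finset.prod_mul_distrib]
  refine Finset.prod_congr rfl fun l hl => ?_
  rw [locRatio_of_dvd (Nat.prime_of_mem_primeFactors hl).one_lt (hα l hl),
    neg_one_pow_quarter (hn l hl) he]

lemma prod_locRatio_odd_of_not_dvd (hn : ∀ l ∈ n.primeFactors, l % 2 = 1)
    (hα : ∀ l ∈ n.primeFactors, ¬ (l : ℤ) ∣ α) {e : ℕ} (he : Odd e) :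
    ∏ l ∈ n.primeFactors, ((locSum α l e : ℝ) / locCount α l)
      = (-1) ^ numPrimesMod8 1 n * (-1) ^ numPrimesMod8 7 n / ∏ l ∈ n.primeFactors, tau l := by
  rw [← prod_ite_mod_eight, ← prod_ite_mod_eight, ← Finset.prod_mul_distrib,
    ← Finset.prod_div_distrib]
  refine Finset.prod_congr rfl fun l hl => ?_
  have h4 : ¬ 4 ∣ e := by rw [Nat.odd_iff] at he; omega
  rw [locRatio_of_not_dvd (hn l hl) (hα l hl) h4, neg_neg_one_pow_quarter (hn l hl) he]

lemma prod_locRatio_even_of_not_dvd (hn : ∀ l ∈ n.primeFactors, l % 2 = 1)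
    (hα : ∀ l ∈ n.primeFactors, ¬ (l : ℤ) ∣ α) {e : ℕ} (he : Even e) (he4 : ¬ 4 ∣ e) :
    ∏ l ∈ n.primeFactors, ((locSum α l e : ℝ) / locCount α l)
      = (-1) ^ numPrimes n / ∏ l ∈ n.primeFactors, tau l := by
  rw [numPrimes, ← Finset.prod_const, ← Finset.prod_div_distrib]
  refine Finset.prod_congr rfl fun l hl => ?_
  rw [locRatio_of_not_dvd (hn l hl) (hα l hl) he4, (he.mul_left _).neg_one_pow]

end products

end LangTrotter

open LangTrotter

theorem mainTheorem9
    (hHL : LangTrotter.HardyLittlewoodConjecture)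
    -- the fixed integer `α ≡ 1 (mod 4)`
    (α : ℤ) (hα : α ≡ 1 [ZMOD 4])
    -- the factorization `D = d * dbar`
    (D d dbar : ℤ) (hD : D = d * dbar) (hd_pos : 0 < d) (hd_odd : Odd d)
    (hd_rad : (LangTrotter.oddRad d : ℤ) ∣ α) (hdbar : IsCoprime α dbar)
    -- `d = dp * dq ^ 2 * dl ^ 3`
    (dp dq dl : ℕ) (hd : d = (dp : ℤ) * (dq : ℤ) ^ 2 * (dl : ℤ) ^ 3)
    (hdp : Squarefree dp) (hdq : Squarefree dq) (hdl : Squarefree dl)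
    (hdpq : Nat.Coprime dp dq) (hdpl : Nat.Coprime dp dl) (hdql : Nat.Coprime dq dl)
    -- `dbar = ± 2 ^ σ * bp * bq ^ 2 * bl ^ 3`
    (ε : ℤˣ) (σ : ℕ) (hσ : σ ≤ 3) (bp bq bl : ℕ)
    (hb : dbar = (ε : ℤ) * 2 ^ σ * (bp : ℤ) * (bq : ℤ) ^ 2 * (bl : ℤ) ^ 3)
    (hbp : Squarefree bp) (hbq : Squarefree bq) (hbl : Squarefree bl)
    (hbp_odd : Odd bp) (hbq_odd : Odd bq) (hbl_odd : Odd bl)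
    (hbpq : Nat.Coprime bp bq) (hbpl : Nat.Coprime bp bl) (hbql : Nat.Coprime bq bl) :
    -- (1) `D` odd
    (D ≡ 1 [ZMOD 4] →
      LangTrotter.HasTraceDensity D α
        (1 / 4 * (1 + LangTrotter.quadTerm bp bl + 2 * LangTrotter.quartTerm dp dl bp bq bl)) ∧
      LangTrotter.HasTraceDensity D (-α)
        (1 / 4 * (1 + LangTrotter.quadTerm bp bl - 2 * LangTrotter.quartTerm dp dl bp bq bl))) ∧
    (D ≡ 3 [ZMOD 4] →
      LangTrotter.HasTraceDensity D α (1 / 4 * (1 + LangTrotter.quadTerm bp bl)) ∧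
      LangTrotter.HasTraceDensity D (-α) (1 / 4 * (1 + LangTrotter.quadTerm bp bl))) ∧
    -- (2) `D` even
    (4 ∣ D → ¬ 8 ∣ D → D / 4 ≡ 1 [ZMOD 4] →
      LangTrotter.HasTraceDensity D α (1 / 4 * (1 + LangTrotter.quadTerm bp bl)) ∧
      LangTrotter.HasTraceDensity D (-α) (1 / 4 * (1 + LangTrotter.quadTerm bp bl))) ∧
    (4 ∣ D → ¬ 8 ∣ D → D / 4 ≡ 3 [ZMOD 4] →
      LangTrotter.HasTraceDensity D α
        (1 / 4 * (1 + LangTrotter.quadTerm bp bl + 2 * LangTrotter.quartTerm dp dl bp bq bl)) ∧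
      LangTrotter.HasTraceDensity D (-α)
        (1 / 4 * (1 + LangTrotter.quadTerm bp bl - 2 * LangTrotter.quartTerm dp dl bp bq bl))) ∧
    ((2 ∣ D ∧ ¬ 4 ∣ D) ∨ (8 ∣ D ∧ ¬ 16 ∣ D) →
      LangTrotter.HasTraceDensity D α (1 / 4) ∧
      LangTrotter.HasTraceDensity D (-α) (1 / 4)) := by
  have hα4 : α % 4 = 1 := hα
  set Nd : ℕ := dp * dq ^ 2 * dl ^ 3 with hNd
  set Nb : ℕ := bp * bq ^ 2 * bl ^ 3 with hNb
  have hdN : d = (Nd : ℤ) := by rw [hd, hNd]; push_cast; rfl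
  have hbN : dbar = (ε : ℤ) * 2 ^ σ * (Nb : ℤ) := by rw [hb, hNb]; push_cast; ring
  have hNd_odd : Odd Nd := by rw [hdN] at hd_odd; exact_mod_cast hd_odd
  have hNb_odd : Odd Nb := (hbp_odd.mul hbq_odd.pow).mul hbl_odd.pow
  -- the primes dividing `d` divide `α`, those dividing `dbar` do not
  have hdα : ∀ l : ℕ, l.Prime → l ∣ Nd → (l : ℤ) ∣ α := by
    intro l hl hlN
    refine dvd_trans ?_ hd_rad
    have hne : l ≠ 2 := by
      rintro rfl
      exact (Nat.not_even_iff_odd.2 hNd_odd) (even_iff_two_dvd.2 hlN)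
    rw [oddRad, hdN, Int.natAbs_natCast]
    exact_mod_cast Finset.dvd_prod_of_mem (fun l => l)
      (Finset.mem_erase.2 ⟨hne, Nat.mem_primeFactors.2 ⟨hl, hlN, hNd_odd.pos.ne'⟩⟩)
  have hbα : ∀ l : ℕ, l.Prime → l ∣ Nb → ¬ (l : ℤ) ∣ α := by
    intro l hl hlN h
    have h1 : (l : ℤ) ∣ dbar := by
      rw [hbN]
      exact (Int.natCast_dvd_natCast.2 hlN).mul_left _
    exact (Nat.prime_iff_prime_int.1 hl).not_isUnit (hdbar.isUnit_of_dvd' h h1)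
  have hcop : Nd.Coprime Nb := Nat.coprime_of_dvd fun l hl h1 h2 => hbα l hl h2 (hdα l hl h1)
  set N := Nd * Nb with hN
  have hN_odd : Odd N := hNd_odd.mul hNb_odd
  have hodd : ∀ l : ℕ, l ∣ N → l % 2 = 1 := fun l hl => Nat.odd_iff.1 (hN_odd.of_dvd_nat hl)
  have hL : ∀ l ∈ N.primeFactors, l.Prime ∧ l % 2 = 1 := fun l hl =>
    ⟨Nat.prime_of_mem_primeFactors hl, hodd l (Nat.dvd_of_mem_primeFactors hl)⟩
  -- the six families of primes
  have hdp' : ∀ l ∈ dp.primeFactors, l ∣ Nd := fun l hl =>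
    ((Nat.dvd_of_mem_primeFactors hl).mul_right _).mul_right _
  have hdq' : ∀ l ∈ dq.primeFactors, l ∣ Nd := fun l hl =>
    ((dvd_pow (Nat.dvd_of_mem_primeFactors hl) two_ne_zero).mul_left _).mul_right _
  have hdl' : ∀ l ∈ dl.primeFactors, l ∣ Nd := fun l hl =>
    (dvd_pow (Nat.dvd_of_mem_primeFactors hl) three_ne_zero).mul_left _
  have hbp' : ∀ l ∈ bp.primeFactors, l ∣ Nb := fun l hl =>
    ((Nat.dvd_of_mem_primeFactors hl).mul_right _).mul_right _
  have hbq' : ∀ l ∈ bq.primeFactors, l ∣ Nb := fun l hl =>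
    ((dvd_pow (Nat.dvd_of_mem_primeFactors hl) two_ne_zero).mul_left _).mul_right _
  have hbl' : ∀ l ∈ bl.primeFactors, l ∣ Nb := fun l hl =>
    (dvd_pow (Nat.dvd_of_mem_primeFactors hl) three_ne_zero).mul_left _
  have hpr : ∀ {n : ℕ}, ∀ l ∈ n.primeFactors, l.Prime := fun l hl =>
    Nat.prime_of_mem_primeFactors hl
  have hprod : ∀ F : ℕ → ℕ → ℝ, ∏ l ∈ N.primeFactors, F l (N.factorization l) =
      ((∏ l ∈ dp.primeFactors, F l 1) * (∏ l ∈ dq.primeFactors, F l 2)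
        * ∏ l ∈ dl.primeFactors, F l 3) *
      ((∏ l ∈ bp.primeFactors, F l 1) * (∏ l ∈ bq.primeFactors, F l 2)
        * ∏ l ∈ bl.primeFactors, F l 3) := fun F => by
    rw [← factorization_prod_cubefull hdp hdq hdl hdpq hdpl hdql,
      ← factorization_prod_cubefull hbp hbq hbl hbpq hbpl hbql,
      ← factorization_prod_mul hcop]
    rfl
  have hquad : ∏ l ∈ N.primeFactors,
      ((locSum α l (2 * N.factorization l) : ℝ) / locCount α l) = quadTerm bp bl := by
    rw [hprod (fun l e => (locSum α l (2 * e) : ℝ) / locCount α l)]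
    simp only [Nat.reduceMul]
    rw [prod_locRatio_even_of_dvd (fun l hl => hdα l (hpr l hl) (hdp' l hl)) (by decide),
      prod_locRatio_even_of_dvd (fun l hl => hdα l (hpr l hl) (hdq' l hl)) (by decide),
      prod_locRatio_even_of_dvd (fun l hl => hdα l (hpr l hl) (hdl' l hl)) (by decide),
      prod_locRatio_even_of_not_dvd (fun l hl => hodd l ((hbp' l hl).mul_left _))
        (fun l hl => hbα l (hpr l hl) (hbp' l hl)) (by decide) (by decide),
      prod_locRatio_even_of_not_dvd (fun l hl => hodd l ((hbl' l hl).mul_left _))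
        (fun l hl => hbα l (hpr l hl) (hbl' l hl)) (by decide) (by decide),
      Finset.prod_eq_one (s := bq.primeFactors) fun l hl =>
        locRatio_four (hodd l ((hbq' l hl).mul_left _)) (hpr l hl).one_lt,
      quadTerm, hbpl.primeFactors_mul, Finset.prod_union hbpl.disjoint_primeFactors, pow_add]
    ring
  have hquart : ∏ l ∈ N.primeFactors,
      ((locSum α l (N.factorization l) : ℝ) / locCount α l) = quartTerm dp dl bp bq bl := by
    rw [hprod (fun l e => (locSum α l e : ℝ) / locCount α l),
      prod_locRatio_odd_of_dvd (fun l hl => hodd l ((hdp' l hl).mul_right _))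
        (fun l hl => hdα l (hpr l hl) (hdp' l hl)) (by decide),
      prod_locRatio_even_of_dvd (fun l hl => hdα l (hpr l hl) (hdq' l hl)) (by decide),
      prod_locRatio_odd_of_dvd (fun l hl => hodd l ((hdl' l hl).mul_right _))
        (fun l hl => hdα l (hpr l hl) (hdl' l hl)) (by decide),
      prod_locRatio_odd_of_not_dvd (fun l hl => hodd l ((hbp' l hl).mul_left _))
        (fun l hl => hbα l (hpr l hl) (hbp' l hl)) (by decide),
      prod_locRatio_even_of_not_dvd (fun l hl => hodd l ((hbq' l hl).mul_left _))
        (fun l hl => hbα l (hpr l hl) (hbq' l hl)) (by decide) (by decide),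
      prod_locRatio_odd_of_not_dvd (fun l hl => hodd l ((hbl' l hl).mul_left _))
        (fun l hl => hbα l (hpr l hl) (hbl' l hl)) (by decide),
      quartTerm, (Nat.Coprime.mul_left hbpl hbql).primeFactors_mul, hbpq.primeFactors_mul,
      Finset.prod_union (by
        rw [← hbpq.primeFactors_mul]
        exact (Nat.Coprime.mul_left hbpl hbql).disjoint_primeFactors),
      Finset.prod_union hbpq.disjoint_primeFactors]
    simp only [pow_add]
    ring
  -- `-D = s 2 ^ σ P` with `P ≡ 1 (mod 4)` the product of the powers of the primes `c l`
  set P : ℤ := ∏ l ∈ N.primeFactors, (sgn4 l * l) ^ N.factorization l with hP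
  set c : ℤ := ∏ l ∈ N.primeFactors, sgn4 l ^ N.factorization l with hc
  have hc2 : c * c = 1 := by
    rw [hc, ← Finset.prod_mul_distrib]
    exact Finset.prod_eq_one fun l _ => by rw [← mul_pow, sgn4_sq, one_pow]
  have hPN : P = c * N := by
    rw [hP, hc]
    simp_rw [mul_pow]
    rw [Finset.prod_mul_distrib]
    congr 1
    conv_rhs => rw [← Nat.prod_factorization_pow_eq_self hN_odd.pos.ne']
    rw [Finsupp.prod, Nat.support_factorization]
    push_cast
    rfl
  have hP4 : P % 4 = 1 := by
    have h : P ≡ 1 [ZMOD 4] := by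
      rw [hP]
      refine Finset.prod_induction _ (fun z => z ≡ 1 [ZMOD 4])
        (fun a b ha hb => by simpa using ha.mul hb) rfl fun l hl => ?_
      have h1 : sgn4 l * l ≡ 1 [ZMOD 4] := by
        rcases sgn4_cases (hL l hl).2 with ⟨h, h', -⟩ | ⟨h, h', -⟩ <;> rw [h, Int.ModEq] <;> omega
      simpa using h1.pow (N.factorization l)
    exact h
  set s : ℤ := -(ε * c) with hsdef
  have hε : (ε : ℤ) * ε = 1 := by
    rw [← Units.val_mul, Int.units_mul_self, Units.val_one]
  have hs : s = 1 ∨ s = -1 := by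
    apply mul_self_eq_one_iff.1
    rw [hsdef]
    linear_combination (c * c) * hε + hc2
  have hDs : -D = s * 2 ^ σ * P := by
    rw [hD, hdN, hbN, hPN, hsdef, hN]
    push_cast
    linear_combination ((ε : ℤ) * 2 ^ σ * Nd * Nb) * hc2
  have hD0 : D ≠ 0 := by
    intro h0
    rw [h0, neg_zero] at hDs
    have : P ≠ 0 := by rintro h; rw [h] at hP4; simp at hP4
    rcases hs with h | h <;> rw [h] at hDs <;> simp [this] at hDs
  have hpos := hasTraceDensity_of_local hHL hα4 hL hD0 hs hDs (t := 1) (.inl rfl)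
  have hneg := hasTraceDensity_of_local hHL hα4 hL hD0 hs hDs (t := -1) (.inr rfl)
  rw [hquad, hquart] at hpos hneg
  rw [one_mul] at hpos
  rw [neg_one_mul] at hneg
  clear_value P s
  clear hprod hquad hquart
  -- `q ^ 2` and `q` contribute only if `4` divides `2 K` and `K`, where `K = σ + 2` for `s = 1` and
  -- `K = σ + 4` for `s = -1`; the class of `D` modulo powers of `2` determines `σ` and `s`
  have hfin : ∀ a b : ℝ, ∀ K : ℕ, signExp s σ = K →
      1 / 4 * (1 + (if 4 ∣ 2 * K then 1 else 0) * quadTerm bp bl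
        + 2 * ((1 : ℤ) : ℝ) * ((if 4 ∣ K then 1 else 0) * quartTerm dp dl bp bq bl)) = a →
      1 / 4 * (1 + (if 4 ∣ 2 * K then 1 else 0) * quadTerm bp bl
        + 2 * ((-1 : ℤ) : ℝ) * ((if 4 ∣ K then 1 else 0) * quartTerm dp dl bp bq bl)) = b →
      HasTraceDensity D α a ∧ HasTraceDensity D (-α) b := by
    rintro a b K rfl rfl rfl
    exact ⟨hpos, hneg⟩
  refine ⟨fun h => ?_, fun h => ?_, fun h h' h'' => ?_, fun h h' h'' => ?_, fun h => ?_⟩ <;>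
    simp only [Int.ModEq] at * <;>
    interval_cases σ <;> rcases hs with hs | hs <;> rw [hs] at hDs <;>
    first
      | (exfalso; omega)
      | (refine hfin _ _ _ (by rw [signExp, hs]) ?_ ?_ <;> norm_num [sub_eq_add_neg])
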